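/- Let $\mathbb{K}$ be a field of characteristic $0$. Let $\mathcal{P}$ be one of the following operads over $\mathbb{K}$, each given by binary generating operations and relations, with $\mathcal{P}(0)=0$, $\mathcal{P}(1)=\mathbb{K}$, and with $\overline{\mathcal{P}}$ the part of arity $\ge 2$: * $\mathcal{P}oiss$, the operad of Poisson algebras: a commutative associative product and a Lie bracket, both of degree $0$, with $[xy,z]=x[y,z]+[x,z]y$; * $\mathcal{P}erm$, the operad of Perm algebras: one product of degree $0$ with $(xy)z=x(yz)=x(zy)$; * $\mathcal{G}erst$, the operad of Gerstenhaber algebras: a commutative associative product of degree $0$ and a bracket of homological degree $1$, symmetric on elements of degree $0$, with the Jacobi relation $[[x,y],z]+[[y,z],x]+[[z,x],y]=0$ and $[xy,z]=x[y,z]+[x,z]y$ (for $x,y,z$ of degree $0$; Koszul signs in general). Let $B(\mathcal{P})=\mathcal{F}^c(s\overline{\mathcal{P}})$ be the bar construction of $\mathcal{P}$, with the universal twisting morphism $\pi\colon B(\mathcal{P})\twoheadrightarrow s\overline{\mathcal{P}}\cong\overline{\mathcal{P}}\rightarrowtail\mathcal{P}$. Let $I$ be the unit $\mathbb{S}$-module,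 and regard it as a left $\mathcal{P}$-module through the augmentation. Let $M\circ_{(1)}N$ denote the part of $M\circ(I\oplus N)$ that is linear in $N$; more generally $\mathcal{P}\circ_{(1)}(N\circ\mathcal{P})$ stands for the part of $\mathcal{P}\circ(\mathcal{P}\oplus (N\circ\mathcal{P}))$ that is linear in $N\circ\mathcal P$, modulo the composition of $\mathcal{P}$ with the inputs of the root that do not carry $N\circ\mathcal{P}$. Put: * $L_{\mathcal{P}}=\mathcal{P}\circ_{(1)}(B(\mathcal{P})\circ\mathcal{P})$ (the functorial cotangent complex), with the differential given by the differential of $B(\mathcal{P})$ and by the two twisting terms that split off an operation of $B(\mathcal{P})$ with the partial, respectively total, decomposition map, apply $\pi$ to it, and compose the result into the copy of $\mathcal{P}$ below, respectively into the copies of $\mathcal{P}$ above; and $\overline{L}_{\mathcal{P}}=L_{\mathcal{P}}\circ_{\mathcal{P}}I$; * $\Omega_{\mathcal{P}}$ (the functorial module of Kähler differential forms), the coequalizer of the two maps $\mathcal{P}\circ_{(1)}(\mathcal{P}\circ\mathcal{P})\rightrightarrows\mathcal{P}\circ_{(1)}\mathcal{P}$, one of which is the composition in the distinguished $\mathcal{P}\circ\mathcal{P}$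 and the other of which sends an operation $p$ at the distinguished input to the sum over the inputs $i$ of $p$ of its composite with the operation at the root, the $i$-th input becoming the distinguished one; and $\overline{\Omega}_{\mathcal{P}}=\Omega_{\mathcal{P}}\circ_{\mathcal{P}}I$; * $\mathbb{O}_{\mathcal{P}}=\ker(\overline{L}_{\mathcal{P}}\twoheadrightarrow\overline{\Omega}_{\mathcal{P}})$, the module of obstructions, a chain complex of $\mathbb{S}$-modules, graded by the total homological degree. Then the first homology of the module of obstructions does not vanish in these three cases: $$H_1(\mathbb{O}_{\mathcal{P}oiss})\neq 0,\qquad H_1(\mathbb{O}_{\mathcal{P}erm})\neq 0,\qquad H_1(\mathbb{O}_{\mathcal{G}erst})\neq 0,$$ that is, for each of the three operads there is an arity $n$ with $H_1(\mathbb{O}_{\mathcal{P}}(n))\neq 0$. -/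

import Mathlib

open CategoryTheory

namespace OperadObstruction

/-- Planar binary trees with vertices decorated by `N` and leaves decorated by `X`. -/
inductive BTree (N X : Type) : Type
  | leaf (x : X) : BTree N X
  | node (a : N) (l r : BTree N X) : BTree N X

namespace BTree

variable {N X : Type}

/-- The decorations of the leaves, from left to right. -/
def leaves : BTree N X → List X
  | leaf x => [x]
  | node _ l r => leaves l ++ leaves r

/-- The tree is not reduced to a leaf. -/
def IsNode : BTree N X → Prop
  | leaf _ => False
  | node _ _ _ => True

/-- The total degree of the vertices, each vertex decorated by `e` counting for `d e`. -/
def vdeg (d : N → ℕ) : BTree N X → ℕ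
  | leaf _ => 0
  | node e l r => d e + vdeg d l + vdeg d r

/-- Exponent of the Koszul sign of the rearrangement of `w ⊗ a₀ ⊗ a₁ ⊗ a₂` into the tree obtained
from `w` by putting `aₓ` at the leaf `x`, where `δ x` is the degree of `aₓ`, the vertex `e` has
degree `d e`, and the vertices and leaves of a tree are read in the order
"vertex, left subtree, right subtree". -/
def koszul (d : N → ℕ) (δ : Fin 3 → ℕ) : BTree N (Fin 3) → ℕ
  | leaf _ => 0
  | node _ l r => koszul d δ l + koszul d δ r + (l.leaves.map δ).sum * vdeg d r
      + (l.leaves.map fun x => (r.leaves.map fun y => if y < x then δ x * δ y else 0).sum).sum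

end BTree

open BTree

/-- A presentation `(E, R)` of a graded binary quadratic operad `𝒫 = ℱ(E)/(R)` over `K`:
a set `E` of binary operations `e(x₀, x₁)` of homological degree `deg e ≥ 0`, and a set of
homogeneous multilinear relations.  The relations in the variables `x₀, x₁` describe the symmetries
of the generating operations, the relations in `x₀, x₁, x₂` are the quadratic ones.  A tree
`node e (leaf x) (node e' (leaf y) (leaf z))` stands for the monomial `e(x, e'(y, z))`, where the
variables have degree `0`. -/
structure BinaryPresentation (K : Type*) [Field K] where
  E : Type
  deg : E → ℕ
  rel : Set (BTree E (Fin 3) →₀ K)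
  rel_leaves : ∀ r ∈ rel, (∀ w ∈ r.support, w.leaves.Perm [0, 1]) ∨
    (∀ w ∈ r.support, w.leaves.Perm [0, 1, 2])
  rel_deg : ∀ r ∈ rel, ∃ m, ∀ w ∈ r.support, w.vdeg deg = m

namespace BinaryPresentation

variable {K : Type*} [Field K] (P : BinaryPresentation K) (Y : Type)

/-- Trees whose vertices are generating operations `(false, e) = e` or suspended generating
operations `(true, e) = s e`, and whose leaves are labelled by `Y`, possibly marked
(`(y, true)` is the leaf `y` with a mark). -/
abbrev Tree : Type := BTree (Bool × P.E) (Y × Bool)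

/-- Formal linear combinations of trees. -/
abbrev Words : Type _ := P.Tree Y →₀ K

variable {P Y}

/-- The homological degree: the suspension `s` has degree `1`. -/
def tdeg (t : P.Tree Y) : ℕ := t.vdeg fun a => a.1.toNat + P.deg a.2

/-- The labels of the leaves. -/
def labels (t : P.Tree Y) : List Y := t.leaves.map Prod.fst

/-- No suspension and no mark: a monomial in the generating operations. -/
def isPlain : P.Tree Y → Bool
  | leaf x => !x.2
  | node a l r => !a.1 && isPlain l && isPlain r

/-- Trees without mark on the leaves. -/
def IsBranch : P.Tree Y → Prop
  | leaf x => x.2 = false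
  | node _ l r => IsBranch l ∧ IsBranch r

/-- The words that generate `𝒫 ∘₍₁₎ (B(𝒫))`.  Such a word consists of a monomial `u ∈ 𝒫` (the
vertices at the root, without suspension), one input of which carries an element of the bar
construction `B(𝒫) = ℱᶜ(s𝒫̄)`.  This element is either the identity (then the input is a
marked leaf), or a tree of vertices in `s𝒫̄`: a vertex `s e` starts a new element of
`s𝒫̄`, which contains the vertices without suspension that can be reached from there without
meeting another suspension. -/
def IsWord : P.Tree Y → Prop
  | leaf x => x.2 = true
  | node (true, _) l r => IsBranch l ∧ IsBranch r
  | node (false, _) l r => (IsWord l ∧ isPlain r = true) ∨ (isPlain l = true ∧ IsWord r)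

/-- The words such that an operation of `𝒫̄` is composed at an input of `u` other than the
distinguished one. -/
def IsDecomposable : P.Tree Y → Prop
  | leaf _ => False
  | node (true, _) _ _ => False
  | node (false, _) l r =>
      (IsWord l ∧ isPlain r = true ∧ r.IsNode) ∨ (isPlain l = true ∧ l.IsNode ∧ IsWord r) ∨
      (IsDecomposable l ∧ isPlain r = true) ∨ (isPlain l = true ∧ IsDecomposable r)

/-- Some vertex is suspended. -/
def HasSusp : P.Tree Y → Prop
  | leaf _ => False
  | node a l r => a.1 = true ∨ HasSusp l ∨ HasSusp r

/-- The bilinear extension of `(l, r) ↦ node a l r`. -/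
noncomputable def graft (a : Bool × P.E) : P.Words Y →ₗ[K] P.Words Y →ₗ[K] P.Words Y :=
  Finsupp.linearCombination K fun l => Finsupp.lmapDomain K K fun r => node a l r

/-- The formal linear combination given by one tree. -/
noncomputable abbrev single (t : P.Tree Y) : P.Words Y := Finsupp.single t 1

/-! ### Relations -/

/-- Replace the leaf `x` of the monomial `w` by the tree `a x`.  If `b` is `true`, then
the root vertex of `w` is suspended. -/
def subst (b : Bool) : BTree P.E (Fin 3) → (Fin 3 → P.Tree Y) → P.Tree Y
  | leaf x, a => a x
  | node e l r, a => node (b, e) (subst false l a) (subst false r a)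

/-- The value of the relation `r` on `a₀, a₁, a₂`, with the root vertex suspended if `b` is
`true`. -/
noncomputable def evalRel (b : Bool) (r : BTree P.E (Fin 3) →₀ K) (a : Fin 3 → P.Tree Y) :
    P.Words Y :=
  r.sum fun w c => Finsupp.single (subst b w a) (c * (-1) ^ w.koszul P.deg (fun x => tdeg (a x)))

/-- The relations of `𝒫` applied to adjacent vertices that belong to the same operation. -/
inductive IsRel : P.Words Y → Prop
  | eval (b : Bool) (r : BTree P.E (Fin 3) →₀ K) (hr : r ∈ P.rel) (a : Fin 3 → P.Tree Y) :
      IsRel (evalRel b r a)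
  | left (a : Bool × P.E) (f : P.Words Y) (t : P.Tree Y) : IsRel f → IsRel (graft a f (single t))
  | right (a : Bool × P.E) (t : P.Tree Y) (f : P.Words Y) : IsRel f → IsRel (graft a (single t) f)

variable (P Y) in
/-- The span of the relations of `𝒫`. -/
noncomputable def relSpan : Submodule K (P.Words Y) := Submodule.span K {f | IsRel f}

variable (P Y) in
/-- The span of the decomposable words. -/
noncomputable def decSpan : Submodule K (P.Words Y) :=
  Submodule.span K {f | ∃ t : P.Tree Y, IsDecomposable t ∧ f = single t}

variable (P Y) in
/-- The relations of `L̄_𝒫 = L_𝒫 ∘_𝒫 I`, where `L_𝒫 = 𝒫 ∘₍₁₎ (B(𝒫) ∘ 𝒫)`. -/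
noncomputable def relL : Submodule K (P.Words Y) := relSpan P Y ⊔ decSpan P Y

/-! ### The differential -/

/-- Write an element `t` of `ℱᶜ(s𝒫̄)`, with the suspension of its root removed, as a sum of words
whose monomial at the root is the root operation `p` of `t`, according to the partial
coproduct `Δₚ` of `ℱᶜ(s𝒫̄)`: if exactly one input of `p` carries a suspended vertex, the result is
`t` itself; if no input does, the result is the sum of the `t` with one leaf marked; and it is
zero if at least two inputs do. -/
noncomputable def mark : P.Tree Y → P.Words Y
  | leaf x => single (leaf (x.1, true))
  | node (true, e) l r => single (node (true, e) l r)
  | node (false, e) l r =>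
      (if isPlain r then graft (false, e) (mark l) (single r) else 0) +
      (if isPlain l then graft (false, e) (single l) (mark r) else 0)

/-- The contraction of the edges below suspended vertices: sum over the suspended vertices of the
tree in which this suspension `s` is removed, with the Koszul sign that comes from moving an
operator of degree `-1` to this `s`. -/
noncomputable def contract : P.Tree Y → P.Words Y
  | leaf _ => 0
  | node (b, e) l r =>
      (if b then single (node (false, e) l r) else 0) +
      (-1 : K) ^ (b.toNat + P.deg e) • (graft (b, e) (contract l) (single r) +
        (-1 : K) ^ tdeg l • graft (b, e) (single l) (contract r))

/-- The opposite of the differential on words: sum, with Koszul signs, of the contractions of the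
edges between two operations in `s𝒫̄`, which give the differential of the bar construction, and
of the twisting term, which composes the operation in `s𝒫̄` above the monomial `u` at the root
with `u`. -/
noncomputable def twist : P.Tree Y → P.Words Y
  | leaf _ => 0
  | node (false, e) l r =>
      (-1 : K) ^ P.deg e • (graft (false, e) (twist l) (single r) +
        (-1 : K) ^ tdeg l • graft (false, e) (single l) (twist r))
  | node (true, e) l r =>
      mark (node (false, e) l r) +
      (-1 : K) ^ (1 + P.deg e) • (graft (true, e) (contract l) (single r) +
        (-1 : K) ^ tdeg l • graft (true, e) (single l) (contract r))

noncomputable def markL : P.Words Y →ₗ[K] P.Words Y := Finsupp.linearCombination K mark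

noncomputable def contractL : P.Words Y →ₗ[K] P.Words Y := Finsupp.linearCombination K contract

noncomputable def twistL : P.Words Y →ₗ[K] P.Words Y := Finsupp.linearCombination K twist

/-! ### Kähler differentials -/

/-- The relations `∑ᵢ (u ∘ p)ᵢ = 0`, where `p ∈ 𝒫̄` is composed at the distinguished input
of `u`, and where the sum is over the inputs `i` of `p`, the `i`-th one becoming the
distinguished one. -/
inductive IsLeibniz : P.Words Y → Prop
  | base (p : P.Tree Y) (hp : isPlain p = true) (h : p.IsNode) : IsLeibniz (mark p)
  | left (e : P.E) (f : P.Words Y) (q : P.Tree Y) (hq : isPlain q = true) :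
      IsLeibniz f → IsLeibniz (graft (false, e) f (single q))
  | right (e : P.E) (q : P.Tree Y) (f : P.Words Y) (hq : isPlain q = true) :
      IsLeibniz f → IsLeibniz (graft (false, e) (single q) f)

variable (P Y) in
noncomputable def omegaSpan : Submodule K (P.Words Y) :=
  Submodule.span K {f | ∃ t : P.Tree Y, HasSusp t ∧ f = single t} ⊔
    Submodule.span K {f | IsLeibniz f}

variable (P Y) in
/-- The relations of `Ω̄_𝒫 = Ω_𝒫 ∘_𝒫 I`, where `Ω_𝒫` is the coequalizer of
`𝒫 ∘₍₁₎ (𝒫 ∘ 𝒫) ⇉ 𝒫 ∘₍₁₎ 𝒫`: the words without suspension (the others are set to zero) modulo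
the relations of `𝒫`, the decomposable words, and the relations `∑ᵢ (u ∘ p)ᵢ = 0`. -/
noncomputable def relOmega : Submodule K (P.Words Y) := relL P Y ⊔ omegaSpan P Y

/-! ### The differential is compatible with the relations -/

noncomputable def sgnL : P.Words Y →ₗ[K] P.Words Y :=
  Finsupp.linearCombination K fun t => (-1 : K) ^ tdeg t • single t

noncomputable def plainL : P.Words Y →ₗ[K] P.Words Y :=
  Finsupp.linearCombination K fun t => if isPlain t then single t else 0

theorem graft_single_single (a : Bool × P.E) (l r : P.Tree Y) :
    graft a (single l) (single r) = (single (node a l r) : P.Words Y) := by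
  simp [graft]

theorem words_ind {M : Type*} [AddCommGroup M] [Module K M] {φ ψ : P.Words Y →ₗ[K] M}
    (h : ∀ t, φ (single t) = ψ (single t)) : φ = ψ := by
  ext t
  simpa using h t

@[simp] theorem markL_single (t : P.Tree Y) : markL (single t) = mark t := by simp [markL]
@[simp] theorem contractL_single (t : P.Tree Y) : contractL (single t) = contract t := by
  simp [contractL]
@[simp] theorem twistL_single (t : P.Tree Y) : twistL (single t) = twist t := by simp [twistL]
@[simp] theorem sgnL_single (t : P.Tree Y) :
    sgnL (single t) = (-1 : K) ^ tdeg t • (single t : P.Words Y) := by simp [sgnL]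
@[simp] theorem plainL_single (t : P.Tree Y) :
    plainL (single t) = if isPlain t then (single t : P.Words Y) else 0 := by simp [plainL]

theorem bilin_ind {M : Type*} [AddCommGroup M] [Module K M]
    {φ ψ : P.Words Y →ₗ[K] P.Words Y →ₗ[K] M}
    (h : ∀ s t, φ (single s) (single t) = ψ (single s) (single t)) : φ = ψ :=
  words_ind fun s => words_ind fun t => h s t

theorem sgnL_graft (b : Bool) (e : P.E) (f g : P.Words Y) :
    sgnL (graft (b, e) f g) =
      (-1 : K) ^ (b.toNat + P.deg e) • graft (b, e) (sgnL f) (sgnL g) := by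
  have : (graft (b, e) : P.Words Y →ₗ[K] _).compr₂ sgnL =
      (-1 : K) ^ (b.toNat + P.deg e) • (graft (b, e)).compl₁₂ sgnL sgnL :=
    bilin_ind fun s t => by
      simp [graft_single_single, tdeg, vdeg, pow_add, smul_smul, -Finsupp.smul_single, mul_assoc]
      ring_nf
  exact congrArg (fun φ => φ f g) this

theorem plainL_graft_true (e : P.E) (f g : P.Words Y) :
    plainL (graft (true, e) f g) = 0 := by
  have : (graft (true, e) : P.Words Y →ₗ[K] _).compr₂ plainL = 0 :=
    bilin_ind fun s t => by simp [graft_single_single, isPlain]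
  exact congrArg (fun φ => φ f g) this

theorem plainL_graft_false (e : P.E) (f g : P.Words Y) :
    plainL (graft (false, e) f g) = graft (false, e) (plainL f) (plainL g) := by
  have : (graft (false, e) : P.Words Y →ₗ[K] _).compr₂ plainL =
      (graft (false, e)).compl₁₂ plainL plainL :=
    bilin_ind fun s t => by
      by_cases h1 : isPlain s <;> by_cases h2 : isPlain t <;>
        simp [graft_single_single, isPlain, h1, h2]
  exact congrArg (fun φ => φ f g) this

theorem markL_graft_true (e : P.E) (f g : P.Words Y) :
    markL (graft (true, e) f g) = graft (true, e) f g := by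
  have : (graft (true, e) : P.Words Y →ₗ[K] _).compr₂ markL = graft (true, e) :=
    bilin_ind fun s t => by simp [graft_single_single, mark]
  exact congrArg (fun φ => φ f g) this

theorem markL_graft_false (e : P.E) (f g : P.Words Y) :
    markL (graft (false, e) f g) =
      graft (false, e) (markL f) (plainL g) + graft (false, e) (plainL f) (markL g) := by
  have : (graft (false, e) : P.Words Y →ₗ[K] _).compr₂ markL =
      (graft (false, e)).compl₁₂ markL plainL + (graft (false, e)).compl₁₂ plainL markL :=
    bilin_ind fun s t => by
      by_cases h1 : isPlain s <;> by_cases h2 : isPlain t <;>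
        simp [graft_single_single, mark, h1, h2]
  exact congrArg (fun φ => φ f g) this

theorem contractL_graft (b : Bool) (e : P.E) (f g : P.Words Y) :
    contractL (graft (b, e) f g) = (if b then graft (false, e) f g else 0) +
      (-1 : K) ^ (b.toNat + P.deg e) •
        (graft (b, e) (contractL f) g + graft (b, e) (sgnL f) (contractL g)) := by
  have : (graft (b, e) : P.Words Y →ₗ[K] _).compr₂ contractL =
      (if b then graft (false, e) else 0) + (-1 : K) ^ (b.toNat + P.deg e) •
        ((graft (b, e)).compl₁₂ contractL LinearMap.id +
          (graft (b, e)).compl₁₂ sgnL contractL) :=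
    bilin_ind fun s t => by
      cases b <;> simp [graft_single_single, contract, -Finsupp.smul_single]
  have := congrArg (fun φ => φ f g) this
  cases b <;> simpa using this

theorem twistL_graft_false (e : P.E) (f g : P.Words Y) :
    twistL (graft (false, e) f g) = (-1 : K) ^ (P.deg e) •
        (graft (false, e) (twistL f) g + graft (false, e) (sgnL f) (twistL g)) := by
  have : (graft (false, e) : P.Words Y →ₗ[K] _).compr₂ twistL =
      (-1 : K) ^ (P.deg e) •
        ((graft (false, e)).compl₁₂ twistL LinearMap.id +
          (graft (false, e)).compl₁₂ sgnL twistL) :=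
    bilin_ind fun s t => by simp [graft_single_single, twist, -Finsupp.smul_single]
  exact congrArg (fun φ => φ f g) this

theorem twistL_graft_true (e : P.E) (f g : P.Words Y) :
    twistL (graft (true, e) f g) = markL (graft (false, e) f g) + (-1 : K) ^ (1 + P.deg e) •
        (graft (true, e) (contractL f) g + graft (true, e) (sgnL f) (contractL g)) := by
  have : (graft (true, e) : P.Words Y →ₗ[K] _).compr₂ twistL =
      (graft (false, e)).compr₂ markL + (-1 : K) ^ (1 + P.deg e) •
        ((graft (true, e)).compl₁₂ contractL LinearMap.id +
          (graft (true, e)).compl₁₂ sgnL contractL) :=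
    bilin_ind fun s t => by simp [graft_single_single, twist, -Finsupp.smul_single]
  exact congrArg (fun φ => φ f g) this

/-! #### Substitution of trees into a monomial -/

/-- The degree of the vertices and leaves that precede the leaf `x`. -/
def before (d : P.E → ℕ) (δ : Fin 3 → ℕ) (x : Fin 3) : BTree P.E (Fin 3) → ℕ
  | leaf _ => 0
  | node e l r => d e + if x ∈ l.leaves then before d δ x l
      else vdeg d l + (l.leaves.map δ).sum + before d δ x r

/-- The tree `subst b w a` with the linear combination `f` put at the leaf `x`. -/
noncomputable def plug (b : Bool) (w : BTree P.E (Fin 3)) (a : Fin 3 → P.Tree Y) (x : Fin 3) :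
    P.Words Y →ₗ[K] P.Words Y :=
  Finsupp.lmapDomain K K fun t => subst b w (Function.update a x t)

@[simp] theorem plug_single (b : Bool) (w : BTree P.E (Fin 3)) (a : Fin 3 → P.Tree Y) (x : Fin 3)
    (t : P.Tree Y) : (plug b w a x (single t) : P.Words Y) =
      single (subst b w (Function.update a x t)) := by
  simp [plug]

theorem subst_update (b : Bool) (w : BTree P.E (Fin 3)) (a : Fin 3 → P.Tree Y) (x : Fin 3)
    (t : P.Tree Y) (hx : x ∉ w.leaves) : subst b w (Function.update a x t) = subst b w a := by
  induction w generalizing b with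
  | leaf y =>
    simp only [leaves, List.mem_singleton] at hx
    simp [subst, Function.update_of_ne (Ne.symm hx)]
  | node e l r hl hr =>
    simp only [leaves, List.mem_append, not_or] at hx
    simp [subst, hl _ hx.1, hr _ hx.2]

theorem tdeg_subst (w : BTree P.E (Fin 3)) (a : Fin 3 → P.Tree Y) :
    tdeg (subst false w a) = w.vdeg P.deg + (w.leaves.map fun x => tdeg (a x)).sum := by
  induction w with
  | leaf y => simp [subst, vdeg, leaves]
  | node e l r hl hr =>
    have h : tdeg (subst false (node e l r) a) =
        P.deg e + tdeg (subst false l a) + tdeg (subst false r a) := by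
      simp [tdeg, subst, vdeg]
    rw [h, hl, hr]
    simp only [vdeg, leaves, List.map_append, List.sum_append]
    ring

theorem plug_left (b : Bool) (e : P.E) (l r : BTree P.E (Fin 3)) (a : Fin 3 → P.Tree Y)
    (x : Fin 3) (hx : x ∉ r.leaves) (f : P.Words Y) :
    plug b (node e l r) a x f =
      graft (b, e) (plug false l a x f) (single (subst false r a)) := by
  have : (plug b (node e l r) a x : P.Words Y →ₗ[K] _) =
      ((graft (b, e)).flip (single (subst false r a))).comp (plug false l a x) :=
    words_ind fun t => by
      simp [graft_single_single, subst, subst_update _ r a x t hx]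
  exact congrArg (fun φ => φ f) this

theorem plug_right (b : Bool) (e : P.E) (l r : BTree P.E (Fin 3)) (a : Fin 3 → P.Tree Y)
    (x : Fin 3) (hx : x ∉ l.leaves) (f : P.Words Y) :
    plug b (node e l r) a x f =
      graft (b, e) (single (subst false l a)) (plug false r a x f) := by
  have : (plug b (node e l r) a x : P.Words Y →ₗ[K] _) =
      ((graft (b, e)) (single (subst false l a))).comp (plug false r a x) :=
    words_ind fun t => by
      simp [graft_single_single, subst, subst_update _ l a x t hx]
  exact congrArg (fun φ => φ f) this

/-- A graded derivation on the vertices without suspension. -/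
def IsDer (D : P.Tree Y → P.Words Y) : Prop :=
  ∀ e l r, D (node (false, e) l r) = (-1 : K) ^ P.deg e • (graft (false, e) (D l) (single r) +
    (-1 : K) ^ tdeg l • graft (false, e) (single l) (D r))

theorem isDer_contract : IsDer (contract : P.Tree Y → P.Words Y) := fun e l r => by
  simp [contract]

theorem isDer_twist : IsDer (twist : P.Tree Y → P.Words Y) := fun e l r => by
  simp [twist]

/-- Sum over the leaves of `w` of the terms of a derivation. -/
noncomputable def derSum (D : P.Tree Y → P.Words Y) (b : Bool) (w : BTree P.E (Fin 3))
    (a : Fin 3 → P.Tree Y) : P.Words Y :=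
  (w.leaves.map fun x =>
    (-1 : K) ^ before P.deg (fun y => tdeg (a y)) x w • plug b w a x (D (a x))).sum

theorem graft_list_sum_left {ι : Type*} (a : Bool × P.E) (L : List ι) (F : ι → P.Words Y)
    (g : P.Words Y) : graft a (L.map F).sum g = (L.map fun x => graft a (F x) g).sum := by
  induction L with
  | nil => simp
  | cons x L ih => simp [ih]

theorem graft_list_sum_right {ι : Type*} (a : Bool × P.E) (L : List ι) (F : ι → P.Words Y)
    (g : P.Words Y) : graft a g (L.map F).sum = (L.map fun x => graft a g (F x)).sum := by
  induction L with
  | nil => simp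
  | cons x L ih => simp [ih]

theorem smul_list_sum {ι : Type*} (c : K) (L : List ι) (F : ι → P.Words Y) :
    c • (L.map F).sum = (L.map fun x => c • F x).sum := by
  induction L with
  | nil => simp
  | cons x L ih => simp [ih]

theorem derSum_node (D : P.Tree Y → P.Words Y) (b : Bool) (e : P.E) (l r : BTree P.E (Fin 3))
    (a : Fin 3 → P.Tree Y) (h : (node e l r : BTree P.E (Fin 3)).leaves.Nodup) :
    derSum D b (node e l r) a = (-1 : K) ^ P.deg e •
      (graft (b, e) (derSum D false l a) (single (subst false r a)) +
        (-1 : K) ^ tdeg (subst false l a) •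
          graft (b, e) (single (subst false l a)) (derSum D false r a)) := by
  simp only [leaves] at h
  have hd := List.disjoint_of_nodup_append h
  simp only [derSum, leaves, List.map_append, List.sum_append, smul_add]
  congr 1
  · rw [graft_list_sum_left, smul_list_sum]
    congr 1
    refine List.map_congr_left fun x hx => ?_
    rw [plug_left _ _ _ _ _ _ (fun hx' => hd hx hx')]
    simp [before, hx, pow_add, smul_smul]
  · rw [graft_list_sum_right, smul_list_sum, smul_list_sum]
    congr 1
    refine List.map_congr_left fun x hx => ?_
    have hx' : x ∉ l.leaves := fun hx' => hd hx' hx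
    rw [plug_right _ _ _ _ _ _ hx']
    simp [before, hx', pow_add, smul_smul, tdeg_subst, mul_assoc]

theorem derSum_eq {D : P.Tree Y → P.Words Y} (hD : IsDer D) (w : BTree P.E (Fin 3))
    (a : Fin 3 → P.Tree Y) (h : w.leaves.Nodup) : D (subst false w a) = derSum D false w a := by
  induction w with
  | leaf x =>
    have : (plug false (leaf x) a x : P.Words Y →ₗ[K] _) = LinearMap.id :=
      words_ind fun t => by simp [subst]
    simp [derSum, leaves, subst, before, this]
  | node e l r hl hr =>
    rw [derSum_node _ _ _ _ _ _ h]
    simp only [leaves] at h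
    rw [← hl h.of_append_left, ← hr h.of_append_right]
    exact hD e _ _

theorem contract_subst (b : Bool) (e : P.E) (l r : BTree P.E (Fin 3)) (a : Fin 3 → P.Tree Y)
    (h : (node e l r : BTree P.E (Fin 3)).leaves.Nodup) :
    (contract (subst b (node e l r) a) : P.Words Y) =
      (if b then single (subst false (node e l r) a) else 0) +
        (-1 : K) ^ b.toNat • derSum contract b (node e l r) a := by
  rw [derSum_node _ _ _ _ _ _ h]
  simp only [leaves] at h
  rw [← derSum_eq isDer_contract l a h.of_append_left,
    ← derSum_eq isDer_contract r a h.of_append_right]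
  simp [subst, contract, pow_add, smul_smul, mul_assoc]

theorem twist_subst_true (e : P.E) (l r : BTree P.E (Fin 3)) (a : Fin 3 → P.Tree Y)
    (h : (node e l r : BTree P.E (Fin 3)).leaves.Nodup) :
    (twist (subst true (node e l r) a) : P.Words Y) =
      mark (subst false (node e l r) a) - derSum contract true (node e l r) a := by
  rw [derSum_node _ _ _ _ _ _ h]
  simp only [leaves] at h
  rw [← derSum_eq isDer_contract l a h.of_append_left,
    ← derSum_eq isDer_contract r a h.of_append_right]
  simp only [subst, twist]
  rw [pow_add, pow_one, neg_one_mul, neg_smul, sub_eq_add_neg]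

/-! #### Signs -/

theorem neg_one_pow_eq {m n : ℕ} (h : (m : ZMod 2) = n) : (-1 : K) ^ m = (-1) ^ n := by
  have h' : m % 2 = n % 2 := (ZMod.natCast_eq_natCast_iff' m n 2).1 h
  rw [neg_one_pow_eq_pow_mod_two, h', ← neg_one_pow_eq_pow_mod_two]

theorem sum_update_of_notMem (δ : Fin 3 → ℕ) (x : Fin 3) (m : ℕ) (L : List (Fin 3))
    (h : x ∉ L) : (L.map (Function.update δ x m)).sum = (L.map δ).sum := by
  congr 1
  refine List.map_congr_left fun y hy => ?_
  rw [Function.update_of_ne]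
  rintro rfl
  exact h hy

theorem sum_update_of_mem (δ : Fin 3 → ℕ) (x : Fin 3) (m : ℕ) (hm : δ x = m + 1)
    (L : List (Fin 3)) (hL : L.Nodup) (h : x ∈ L) :
    (L.map δ).sum = (L.map (Function.update δ x m)).sum + 1 := by
  induction L with
  | nil => simp at h
  | cons y L ih =>
    rw [List.nodup_cons] at hL
    by_cases hxy : x = y
    · subst hxy
      simp only [List.map_cons, List.sum_cons, Function.update_self, hm,
        sum_update_of_notMem δ x m L hL.1]
      ring
    · have hxL : x ∈ L := by simpa [hxy] using h
      simp only [List.map_cons, List.sum_cons, ih hL.2 hxL,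
        Function.update_of_ne (Ne.symm hxy)]
      ring

/-- The total degree of the `y` in `L` that are smaller than `x`. -/
def below (δ : Fin 3 → ℕ) (x : Fin 3) (L : List (Fin 3)) : ℕ :=
  (L.map fun y => if y < x then δ y else 0).sum

/-- The total degree of the `y` in `L` that are greater than `x`. -/
def above (δ : Fin 3 → ℕ) (x : Fin 3) (L : List (Fin 3)) : ℕ :=
  (L.map fun y => if x < y then δ y else 0).sum

/-- Inversions between two lists. -/
def inv (δ : Fin 3 → ℕ) (L R : List (Fin 3)) : ℕ :=
  (L.map fun x => (R.map fun y => if y < x then δ x * δ y else 0).sum).sum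

theorem below_add_above (δ : Fin 3 → ℕ) (x : Fin 3) (L : List (Fin 3)) (h : x ∉ L) :
    (L.map δ).sum = below δ x L + above δ x L := by
  induction L with
  | nil => simp [below, above]
  | cons y L ih =>
    simp only [List.mem_cons, not_or] at h
    have ih := ih h.2
    simp only [below, above, List.map_cons, List.sum_cons] at ih ⊢
    rcases lt_or_gt_of_ne h.1 with h1 | h1
    · simp [h1, not_lt_of_gt h1, ih]; ring
    · simp [h1, not_lt_of_gt h1, ih]; ring

theorem inv_update_left (δ : Fin 3 → ℕ) (x : Fin 3) (m : ℕ) (hm : δ x = m + 1)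
    (L R : List (Fin 3)) (hL : L.Nodup) (h : x ∈ L) (hR : x ∉ R) :
    inv δ L R = inv (Function.update δ x m) L R + below δ x R := by
  have hrow : ∀ y, y ≠ x → (R.map fun z => if z < y then
      Function.update δ x m y * Function.update δ x m z else 0).sum =
      (R.map fun z => if z < y then δ y * δ z else 0).sum := by
    intro y hy
    congr 1
    refine List.map_congr_left fun z hz => ?_
    have hzx : z ≠ x := by rintro rfl; exact hR hz
    simp [Function.update_of_ne hy, Function.update_of_ne hzx]
  have hx : (R.map fun z => if z < x then δ x * δ z else 0).sum =
      (R.map fun z => if z < x then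
      Function.update δ x m x * Function.update δ x m z else 0).sum + below δ x R := by
    clear hrow
    induction R with
    | nil => simp [below]
    | cons z R ih =>
      simp only [List.mem_cons, not_or] at hR
      simp only [below, List.map_cons, List.sum_cons] at ih ⊢
      rw [ih hR.2]
      have hzx : z ≠ x := Ne.symm hR.1
      by_cases hlt : z < x
      · simp [hlt, Function.update_of_ne hzx, hm]; ring
      · simp [hlt]
  induction L with
  | nil => simp at h
  | cons y L ih =>
    rw [List.nodup_cons] at hL
    simp only [inv, List.map_cons, List.sum_cons] at ih ⊢
    by_cases hxy : x = y
    · subst hxy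
      rw [hx]
      have : (L.map fun y => (R.map fun z => if z < y then δ y * δ z else 0).sum).sum =
          (L.map fun y => (R.map fun z => if z < y then
            Function.update δ x m y * Function.update δ x m z else 0).sum).sum := by
        congr 1
        refine List.map_congr_left fun y hy => (hrow y ?_).symm
        rintro rfl
        exact hL.1 hy
      rw [this]
      ring
    · have hxL : x ∈ L := by simpa [hxy] using h
      rw [ih hL.2 hxL, hrow y (Ne.symm hxy)]
      ring

theorem inv_update_right (δ : Fin 3 → ℕ) (x : Fin 3) (m : ℕ) (hm : δ x = m + 1)
    (L R : List (Fin 3)) (hR : R.Nodup) (h : x ∈ R) (hL : x ∉ L) :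
    inv δ L R = inv (Function.update δ x m) L R + above δ x L := by
  induction L with
  | nil => simp [inv, above]
  | cons y L ih =>
    simp only [List.mem_cons, not_or] at hL
    simp only [inv, above, List.map_cons, List.sum_cons] at ih ⊢
    rw [ih hL.2]
    have hyx : y ≠ x := Ne.symm hL.1
    have hrow : (R.map fun z => if z < y then δ y * δ z else 0).sum =
        (R.map fun z => if z < y then
          Function.update δ x m y * Function.update δ x m z else 0).sum +
          if x < y then δ y else 0 := by
      clear ih
      induction R with
      | nil => simp at h
      | cons z R ihR =>
        rw [List.nodup_cons] at hR
        simp only [List.map_cons, List.sum_cons]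
        by_cases hxz : x = z
        · subst hxz
          have : (R.map fun z => if z < y then
              Function.update δ x m y * Function.update δ x m z else 0) =
              (R.map fun z => if z < y then δ y * δ z else 0) := by
            refine List.map_congr_left fun z hz => ?_
            have hzx : z ≠ x := by rintro rfl; exact hR.1 hz
            simp [Function.update_of_ne hyx, Function.update_of_ne hzx]
          rw [this]
          by_cases hlt : x < y
          · simp [hlt, Function.update_of_ne hyx, hm]; ring
          · simp [hlt]
        · have hxR : x ∈ R := by simpa [hxz] using h
          rw [ihR hR.2 hxR]
          simp [Function.update_of_ne hyx, Function.update_of_ne (Ne.symm hxz)]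
          ring
    rw [hrow]
    ring

theorem koszul_update (d : P.E → ℕ) (δ : Fin 3 → ℕ) (x : Fin 3) (m : ℕ) (hm : δ x = m + 1)
    (w : BTree P.E (Fin 3)) (hw : w.leaves.Nodup) (hx : x ∈ w.leaves) :
    ((w.koszul d δ + before d δ x w : ℕ) : ZMod 2) =
      ((w.koszul d (Function.update δ x m) + w.vdeg d + below δ x w.leaves : ℕ) : ZMod 2) := by
  have notMem : ∀ v : BTree P.E (Fin 3), x ∉ v.leaves →
      v.koszul d (Function.update δ x m) = v.koszul d δ := by
    intro v
    induction v with
    | leaf y => simp [koszul]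
    | node e l r hl hr =>
      intro h
      simp only [leaves, List.mem_append, not_or] at h
      simp only [koszul, hl h.1, hr h.2, sum_update_of_notMem δ x m _ h.1]
      congr 2
      refine List.map_congr_left fun y hy => ?_
      congr 1
      refine List.map_congr_left fun z hz => ?_
      have hyx : y ≠ x := by rintro rfl; exact h.1 hy
      have hzx : z ≠ x := by rintro rfl; exact h.2 hz
      simp [Function.update_of_ne hyx, Function.update_of_ne hzx]
  have two : (2 : ZMod 2) = 0 := rfl
  induction w with
  | leaf y =>
    simp only [leaves, List.mem_singleton] at hx
    subst hx
    simp [koszul, before, vdeg, below, leaves]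
  | node e l r hl hr =>
    simp only [leaves] at hw hx
    have hd := List.disjoint_of_nodup_append hw
    have hbel : below δ x (l.leaves ++ r.leaves) = below δ x l.leaves + below δ x r.leaves := by
      simp [below]
    have kos : ∀ δ' : Fin 3 → ℕ, (node e l r).koszul d δ' =
        l.koszul d δ' + r.koszul d δ' + (l.leaves.map δ').sum * r.vdeg d
          + inv δ' l.leaves r.leaves := fun δ' => rfl
    rw [List.mem_append] at hx
    rw [kos, kos]
    simp only [before, vdeg, leaves, hbel]
    rcases hx with hx | hx
    · have hxr : x ∉ r.leaves := fun h => hd hx h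
      have ih := hl hw.of_append_left hx
      rw [if_pos hx, inv_update_left δ x m hm _ _ hw.of_append_left hx hxr,
        sum_update_of_mem δ x m hm _ hw.of_append_left hx, notMem r hxr]
      push_cast at ih ⊢
      linear_combination ih
    · have hxl : x ∉ l.leaves := fun h => hd h hx
      have ih := hr hw.of_append_right hx
      rw [if_neg hxl, inv_update_right δ x m hm _ _ hw.of_append_right hx hxl,
        sum_update_of_notMem δ x m _ hxl, notMem l hxl]
      have hba := below_add_above δ x _ hxl
      have hba' : (((l.leaves.map δ).sum : ℕ) : ZMod 2) =
        below δ x l.leaves + above δ x l.leaves := by rw [hba]; push_cast; ring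
      push_cast at ih hba' ⊢
      linear_combination ih + hba' + (above δ x l.leaves : ZMod 2) * two

/-! #### The relations are stable -/

theorem evalRel_eq_sum (b : Bool) (r : BTree P.E (Fin 3) →₀ K) (a : Fin 3 → P.Tree Y) :
    (evalRel b r a : P.Words Y) = ∑ w ∈ r.support,
      (r w * (-1) ^ w.koszul P.deg (fun x => tdeg (a x))) • single (subst b w a) := by
  simp [evalRel, Finsupp.sum]

/-- The leaves of a relation: a list that is a permutation of the leaves of each monomial. -/
theorem exists_leaves {r : BTree P.E (Fin 3) →₀ K} (hr : r ∈ P.rel) :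
    ∃ L : List (Fin 3), L.Nodup ∧ 2 ≤ L.length ∧ ∀ w ∈ r.support, w.leaves.Perm L := by
  rcases P.rel_leaves r hr with h | h
  · exact ⟨_, by decide, by simp, h⟩
  · exact ⟨_, by decide, by simp, h⟩

theorem exists_node {w : BTree P.E (Fin 3)} (h : 2 ≤ w.leaves.length) :
    ∃ e l r, w = node e l r := by
  cases w with
  | leaf x => simp [leaves] at h
  | node e l r => exact ⟨e, l, r, rfl⟩

theorem isRel_mem {f : P.Words Y} (hf : IsRel f) : f ∈ relSpan P Y := Submodule.subset_span hf

theorem relSpan_graft_left (a : Bool × P.E) {f : P.Words Y} (hf : f ∈ relSpan P Y)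
    (g : P.Words Y) : graft a f g ∈ relSpan P Y := by
  induction g using Finsupp.induction_linear with
  | zero => simp
  | add g h hg hh => rw [map_add]; exact add_mem hg hh
  | single t c =>
    have : Finsupp.single t c = c • (single t : P.Words Y) := by simp
    rw [this, map_smul]
    refine Submodule.smul_mem _ _ ?_
    induction hf using Submodule.span_induction with
    | mem f hf => exact isRel_mem (.left a f t hf)
    | zero => simp
    | add f g _ _ hf hg => rw [map_add, LinearMap.add_apply]; exact add_mem hf hg
    | smul c f _ hf => rw [map_smul, LinearMap.smul_apply]; exact Submodule.smul_mem _ _ hf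

theorem relSpan_graft_right (a : Bool × P.E) {f : P.Words Y} (hf : f ∈ relSpan P Y)
    (g : P.Words Y) : graft a g f ∈ relSpan P Y := by
  induction g using Finsupp.induction_linear with
  | zero => simp
  | add g h hg hh => rw [map_add, LinearMap.add_apply]; exact add_mem hg hh
  | single t c =>
    have : Finsupp.single t c = c • (single t : P.Words Y) := by simp
    rw [this, map_smul, LinearMap.smul_apply]
    refine Submodule.smul_mem _ _ ?_
    induction hf using Submodule.span_induction with
    | mem f hf => exact isRel_mem (.right a t f hf)
    | zero => simp
    | add f g _ _ hf hg => rw [map_add]; exact add_mem hf hg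
    | smul c f _ hf => rw [map_smul]; exact Submodule.smul_mem _ _ hf

theorem sum_list_map_comm {ι κ M : Type*} [AddCommMonoid M] (s : Finset ι) (L : List κ)
    (F : ι → κ → M) :
    ∑ i ∈ s, (L.map (F i)).sum = (L.map fun x => ∑ i ∈ s, F i x).sum := by
  induction L with
  | nil => simp
  | cons x L ih => simp [Finset.sum_add_distrib, ih]

theorem listSum_mem (S : Submodule K (P.Words Y)) {ι : Type*} (L : List ι) (F : ι → P.Words Y)
    (h : ∀ x ∈ L, F x ∈ S) : (L.map F).sum ∈ S := by
  refine _root_.list_sum_mem ?_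
  intro f hf
  obtain ⟨x, hx, rfl⟩ := List.mem_map.1 hf
  exact h x hx

/-- A linear combination of trees whose degree plus one is `n`. -/
def LowersTo (n : ℕ) (f : P.Words Y) : Prop := ∀ t ∈ f.support, tdeg t + 1 = n

theorem mem_of_single (S : Submodule K (P.Words Y)) (φ : P.Words Y →ₗ[K] P.Words Y)
    (f : P.Words Y) (h : ∀ t ∈ f.support, φ (single t) ∈ S) : φ f ∈ S := by
  have : f = ∑ t ∈ f.support, f t • (single t : P.Words Y) := by
    conv_lhs => rw [← Finsupp.sum_single f]
    simp [Finsupp.sum]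
  rw [this, map_sum]
  refine Submodule.sum_mem _ fun t ht => ?_
  rw [map_smul]
  exact Submodule.smul_mem _ _ (h t ht)

theorem sum_derSum_mem (D : P.Tree Y → P.Words Y) (b : Bool) {r : BTree P.E (Fin 3) →₀ K}
    (hr : r ∈ P.rel) (a : Fin 3 → P.Tree Y) (hD : ∀ x, LowersTo (tdeg (a x)) (D (a x))) :
    ∑ w ∈ r.support, (r w * (-1) ^ w.koszul P.deg (fun x => tdeg (a x))) • derSum D b w a
      ∈ relSpan P Y := by
  obtain ⟨L, hLn, -, hL⟩ := exists_leaves hr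
  obtain ⟨m, hm⟩ := P.rel_deg r hr
  set δ : Fin 3 → ℕ := fun x => tdeg (a x) with hδ
  have h1 : ∀ w ∈ r.support, (r w * (-1) ^ w.koszul P.deg δ) • derSum D b w a =
      (L.map fun x => (r w * (-1) ^ w.koszul P.deg δ) •
        (-1 : K) ^ before P.deg δ x w • plug b w a x (D (a x))).sum := by
    intro w hw
    rw [derSum, ((hL w hw).map _).sum_eq, smul_list_sum]
  rw [Finset.sum_congr rfl h1, sum_list_map_comm]
  refine listSum_mem _ _ _ fun x hx => ?_
  have h2 : ∑ w ∈ r.support, (r w * (-1) ^ w.koszul P.deg δ) •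
        (-1 : K) ^ before P.deg δ x w • plug b w a x (D (a x)) =
      (∑ w ∈ r.support, (r w * (-1) ^ w.koszul P.deg δ) •
        (-1 : K) ^ before P.deg δ x w • plug b w a x : P.Words Y →ₗ[K] P.Words Y) (D (a x)) := by
    simp [LinearMap.sum_apply]
  rw [h2]
  refine mem_of_single _ _ _ fun t ht => ?_
  have hdeg : δ x = tdeg t + 1 := (hD x t ht).symm
  have hupd : (fun y => tdeg (Function.update a x t y)) = Function.update δ x (tdeg t) := by
    funext y
    by_cases hy : y = x
    · subst hy; simp
    · simp [Function.update_of_ne hy, hδ]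
  have h3 : (∑ w ∈ r.support, (r w * (-1) ^ w.koszul P.deg δ) •
        (-1 : K) ^ before P.deg δ x w • plug b w a x : P.Words Y →ₗ[K] P.Words Y) (single t) =
      (-1 : K) ^ (m + below δ x L) • evalRel b r (Function.update a x t) := by
    rw [evalRel_eq_sum, LinearMap.sum_apply, Finset.smul_sum]
    refine Finset.sum_congr rfl fun w hw => ?_
    rw [LinearMap.smul_apply, LinearMap.smul_apply, plug_single, smul_smul, smul_smul, hupd]
    congr 1
    have hk := koszul_update P.deg δ x (tdeg t) hdeg w ((hL w hw).nodup_iff.2 hLn)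
      ((hL w hw).mem_iff.2 hx)
    have hbl : below δ x w.leaves = below δ x L := ((hL w hw).map _).sum_eq
    have := neg_one_pow_eq (K := K) hk
    rw [hm w hw, hbl, pow_add, add_assoc, pow_add] at this
    rw [mul_assoc, this]
    ring
  rw [h3]
  exact Submodule.smul_mem _ _ (isRel_mem (.eval b r hr _))

/-! Degrees and shapes of the terms of `mark`, `contract`, `twist`. -/

theorem graft_supp {A B C : P.Tree Y → Prop} (a : Bool × P.E) {f g : P.Words Y}
    (hf : ∀ t ∈ f.support, A t) (hg : ∀ t ∈ g.support, B t)
    (h : ∀ l r, A l → B r → C (node a l r)) : ∀ t ∈ (graft a f g).support, C t := by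
  suffices graft a f g ∈ Finsupp.supported K K {t | C t} from
    fun t ht => (Finsupp.mem_supported K _).1 this ht
  refine mem_of_single _ ((graft a).flip g) f fun l hl => ?_
  refine mem_of_single _ (graft a (single l)) g fun r hr => ?_
  rw [graft_single_single]
  exact Finsupp.single_mem_supported K _ (h l r (hf l hl) (hg r hr))

theorem supp_single {C : P.Tree Y → Prop} {t : P.Tree Y} (h : C t) :
    ∀ t' ∈ (single t : P.Words Y).support, C t' := fun t' ht' => by
  have := Finsupp.support_single_subset ht'
  rw [Finset.mem_singleton] at this
  exact this ▸ h

theorem supp_add {C : P.Tree Y → Prop} {f g : P.Words Y} (hf : ∀ t ∈ f.support, C t)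
    (hg : ∀ t ∈ g.support, C t) : ∀ t ∈ (f + g).support, C t := fun t ht => by
  classical
  rcases Finset.mem_union.1 (Finsupp.support_add ht) with h | h
  · exact hf t h
  · exact hg t h

theorem supp_smul {C : P.Tree Y → Prop} {f : P.Words Y} (c : K) (hf : ∀ t ∈ f.support, C t) :
    ∀ t ∈ (c • f).support, C t := fun t ht => hf t (Finsupp.support_smul ht)

theorem supp_ite {C : P.Tree Y → Prop} {f : P.Words Y} (p : Prop) [Decidable p]
    (hf : p → ∀ t ∈ f.support, C t) : ∀ t ∈ (if p then f else 0).support, C t := by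
  split_ifs with h
  · exact hf h
  · simp

theorem tdeg_node (b : Bool) (e : P.E) (l r : P.Tree Y) :
    tdeg (node (b, e) l r) = b.toNat + P.deg e + tdeg l + tdeg r := rfl

theorem labels_node (a : Bool × P.E) (l r : P.Tree Y) :
    labels (node a l r) = labels l ++ labels r := by simp [labels, leaves]

theorem isPlain.isBranch {t : P.Tree Y} (h : isPlain t = true) : IsBranch t := by
  induction t with
  | leaf x => simpa [isPlain, IsBranch] using h
  | node a l r hl hr =>
    simp only [isPlain, Bool.and_eq_true] at h
    exact ⟨hl h.1.2, hr h.2⟩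

theorem isPlain.not_hasSusp {t : P.Tree Y} (h : isPlain t = true) : ¬ HasSusp t := by
  induction t with
  | leaf x => simp [HasSusp]
  | node a l r hl hr =>
    simp only [isPlain, Bool.and_eq_true, Bool.not_eq_true'] at h
    simp [HasSusp, h.1.1, hl h.1.2, hr h.2]

theorem contract_spec (t : P.Tree Y) : ∀ t' ∈ (contract t : P.Words Y).support,
    t'.IsNode ∧ tdeg t' + 1 = tdeg t ∧ labels t' = labels t ∧ (IsBranch t → IsBranch t') := by
  induction t with
  | leaf x => simp [contract]
  | node a l r hl hr =>
    obtain ⟨b, e⟩ := a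
    refine supp_add (supp_ite _ fun hb => supp_single ?_) (supp_smul _ (supp_add ?_ (supp_smul _ ?_)))
    · subst hb
      simp [IsNode, tdeg_node, labels_node, IsBranch]
      ring
    · refine graft_supp _ hl (supp_single (C := fun t => t = r) rfl) ?_
      rintro l' _ ⟨-, h1, h2, h3⟩ rfl
      exact ⟨trivial, by rw [tdeg_node, tdeg_node]; omega, by simp [labels_node, h2],
        fun h => ⟨h3 h.1, h.2⟩⟩
    · refine graft_supp _ (supp_single (C := fun t => t = l) rfl) hr ?_
      rintro _ r' rfl ⟨-, h1, h2, h3⟩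
      exact ⟨trivial, by rw [tdeg_node, tdeg_node]; omega, by simp [labels_node, h2],
        fun h => ⟨h.1, h3 h.2⟩⟩

theorem mark_spec (t : P.Tree Y) : ∀ t' ∈ (mark t : P.Words Y).support,
    tdeg t' = tdeg t ∧ labels t' = labels t ∧ (IsBranch t → IsWord t') := by
  induction t with
  | leaf x => exact supp_single ⟨rfl, rfl, fun _ => rfl⟩
  | node a l r hl hr =>
    obtain ⟨b, e⟩ := a
    cases b with
    | true => exact supp_single ⟨rfl, rfl, fun h => h⟩
    | false =>
      refine supp_add (supp_ite _ fun hp => ?_) (supp_ite _ fun hp => ?_)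
      · refine graft_supp _ hl (supp_single (C := fun t => t = r) rfl) ?_
        rintro l' _ ⟨h1, h2, h3⟩ rfl
        exact ⟨by rw [tdeg_node, tdeg_node]; omega, by simp [labels_node, h2],
          fun h => Or.inl ⟨h3 h.1, hp⟩⟩
      · refine graft_supp _ (supp_single (C := fun t => t = l) rfl) hr ?_
        rintro _ r' rfl ⟨h1, h2, h3⟩
        exact ⟨by rw [tdeg_node, tdeg_node]; omega, by simp [labels_node, h2],
          fun h => Or.inr ⟨hp, h3 h.2⟩⟩

theorem twist_plain {t : P.Tree Y} (h : isPlain t = true) : (twist t : P.Words Y) = 0 := by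
  induction t with
  | leaf x => rfl
  | node a l r hl hr =>
    obtain ⟨b, e⟩ := a
    cases b <;> simp [isPlain] at h
    simp [twist, hl h.1, hr h.2]

theorem twist_spec (t : P.Tree Y) : ∀ t' ∈ (twist t : P.Words Y).support,
    tdeg t' + 1 = tdeg t ∧ labels t' = labels t ∧ (IsWord t → IsWord t') := by
  induction t with
  | leaf x => simp [twist]
  | node a l r hl hr =>
    obtain ⟨b, e⟩ := a
    cases b with
    | true =>
      refine supp_add ?_ (supp_smul _ (supp_add ?_ (supp_smul _ ?_)))
      · intro t' ht'
        obtain ⟨h1, h2, h3⟩ := mark_spec _ t' ht'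
        refine ⟨?_, h2, h3⟩
        rw [h1, tdeg_node, tdeg_node]
        simp
        ring
      · refine graft_supp _ (contract_spec l) (supp_single (C := fun t => t = r) rfl) ?_
        rintro l' _ ⟨-, h1, h2, h3⟩ rfl
        exact ⟨by rw [tdeg_node, tdeg_node]; omega, by simp [labels_node, h2],
          fun h => ⟨h3 h.1, h.2⟩⟩
      · refine graft_supp _ (supp_single (C := fun t => t = l) rfl) (contract_spec r) ?_
        rintro _ r' rfl ⟨-, h1, h2, h3⟩
        exact ⟨by rw [tdeg_node, tdeg_node]; omega, by simp [labels_node, h2],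
          fun h => ⟨h.1, h3 h.2⟩⟩
    | false =>
      refine supp_smul _ (supp_add ?_ (supp_smul _ ?_))
      · by_cases hp : isPlain l = true
        · simp [twist_plain hp]
        · refine graft_supp _ hl (supp_single (C := fun t => t = r) rfl) ?_
          rintro l' _ ⟨h1, h2, h3⟩ rfl
          refine ⟨by rw [tdeg_node, tdeg_node]; omega, by simp [labels_node, h2], ?_⟩
          rintro (h | h)
          · exact Or.inl ⟨h3 h.1, h.2⟩
          · exact absurd h.1 hp
      · by_cases hp : isPlain r = true
        · simp [twist_plain hp]
        · refine graft_supp _ (supp_single (C := fun t => t = l) rfl) hr ?_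
          rintro _ r' rfl ⟨h1, h2, h3⟩
          refine ⟨by rw [tdeg_node, tdeg_node]; omega, by simp [labels_node, h2], ?_⟩
          rintro (h | h)
          · exact absurd h.2 hp
          · exact Or.inr ⟨h.1, h3 h.2⟩

/-! Stability of the relations under `mark`, `contract`, `twist`. -/

theorem isPlain_subst (w : BTree P.E (Fin 3)) (a : Fin 3 → P.Tree Y) :
    isPlain (subst false w a) = true ↔ ∀ x ∈ w.leaves, isPlain (a x) = true := by
  induction w with
  | leaf x => simp [subst, leaves]
  | node e l r hl hr =>
    simp only [subst, isPlain, Bool.and_eq_true, hl, hr, leaves, List.mem_append]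
    simp only [Bool.not_false, true_and]
    constructor
    · rintro ⟨h1, h2⟩ x (hx | hx)
      · exact h1 x hx
      · exact h2 x hx
    · exact fun h => ⟨fun x hx => h x (Or.inl hx), fun x hx => h x (Or.inr hx)⟩

theorem mark_subst (w : BTree P.E (Fin 3)) (a : Fin 3 → P.Tree Y) (h : w.leaves.Nodup) :
    (mark (subst false w a) : P.Words Y) = (w.leaves.map fun x =>
      open Classical in if ∀ y ∈ w.leaves, y ≠ x → isPlain (a y) = true then
        plug false w a x (mark (a x)) else 0).sum := by
  classical
  induction w with
  | leaf x =>
    have : (plug false (leaf x) a x : P.Words Y →ₗ[K] _) = LinearMap.id :=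
      words_ind fun t => by simp [subst]
    simp [leaves, subst, this]
  | node e l r hl hr =>
    simp only [leaves] at h
    have hd := List.disjoint_of_nodup_append h
    have key : (mark (subst false (node e l r) a) : P.Words Y) =
      (if isPlain (subst false r a) then
        graft (false, e) (mark (subst false l a)) (single (subst false r a)) else 0) +
      (if isPlain (subst false l a) then
        graft (false, e) (single (subst false l a)) (mark (subst false r a)) else 0) := rfl
    rw [key, hl h.of_append_left, hr h.of_append_right]
    simp only [leaves, List.map_append, List.sum_append]
    congr 1
    · by_cases hp : isPlain (subst false r a) = true
      · rw [if_pos hp, graft_list_sum_left]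
        congr 1
        refine List.map_congr_left fun x hx => ?_
        have hxr : x ∉ r.leaves := fun hx' => hd hx hx'
        rw [isPlain_subst] at hp
        rw [plug_left _ _ _ _ _ _ hxr]
        have : (∀ y ∈ l.leaves, y ≠ x → isPlain (a y) = true) ↔
            ∀ y ∈ l.leaves ++ r.leaves, y ≠ x → isPlain (a y) = true := by
          constructor
          · intro h y hy
            rcases List.mem_append.1 hy with hy | hy
            · exact h y hy
            · exact fun _ => hp y hy
          · exact fun h y hy => h y (List.mem_append_left _ hy)
        by_cases hc : ∀ y ∈ l.leaves, y ≠ x → isPlain (a y) = true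
        · rw [if_pos hc]
          exact (if_pos (this.1 hc)).symm
        · rw [if_neg hc, map_zero, LinearMap.zero_apply]
          exact (if_neg (fun h => hc (this.2 h))).symm
      · rw [if_neg hp]
        symm
        refine List.sum_eq_zero fun f hf => ?_
        obtain ⟨x, hx, rfl⟩ := List.mem_map.1 hf
        refine if_neg fun h' => hp ((isPlain_subst r a).2 fun y hy => h' y
          (List.mem_append_right _ hy) ?_)
        rintro rfl
        exact hd hx hy
    · by_cases hp : isPlain (subst false l a) = true
      · rw [if_pos hp, graft_list_sum_right]
        congr 1
        refine List.map_congr_left fun x hx => ?_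
        have hxl : x ∉ l.leaves := fun hx' => hd hx' hx
        rw [isPlain_subst] at hp
        rw [plug_right _ _ _ _ _ _ hxl]
        have : (∀ y ∈ r.leaves, y ≠ x → isPlain (a y) = true) ↔
            ∀ y ∈ l.leaves ++ r.leaves, y ≠ x → isPlain (a y) = true := by
          constructor
          · intro h y hy
            rcases List.mem_append.1 hy with hy | hy
            · exact fun _ => hp y hy
            · exact h y hy
          · exact fun h y hy => h y (List.mem_append_right _ hy)
        by_cases hc : ∀ y ∈ r.leaves, y ≠ x → isPlain (a y) = true
        · rw [if_pos hc]
          exact (if_pos (this.1 hc)).symm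
        · rw [if_neg hc, map_zero]
          exact (if_neg (fun h => hc (this.2 h))).symm
      · rw [if_neg hp]
        symm
        refine List.sum_eq_zero fun f hf => ?_
        obtain ⟨x, hx, rfl⟩ := List.mem_map.1 hf
        refine if_neg fun h' => hp ((isPlain_subst l a).2 fun y hy => h' y
          (List.mem_append_left _ hy) ?_)
        rintro rfl
        exact hd hy hx

theorem map_evalRel (φ : P.Words Y →ₗ[K] P.Words Y) (b : Bool) (r : BTree P.E (Fin 3) →₀ K)
    (a : Fin 3 → P.Tree Y) : φ (evalRel b r a) = ∑ w ∈ r.support,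
      (r w * (-1) ^ w.koszul P.deg (fun x => tdeg (a x))) • φ (single (subst b w a)) := by
  rw [evalRel_eq_sum, map_sum]
  simp only [map_smul]

theorem markL_evalRel (b : Bool) {r : BTree P.E (Fin 3) →₀ K} (hr : r ∈ P.rel)
    (a : Fin 3 → P.Tree Y) : markL (evalRel b r a) ∈ relSpan P Y := by
  classical
  obtain ⟨L, hLn, hL2, hL⟩ := exists_leaves hr
  cases b with
  | true =>
    convert isRel_mem (IsRel.eval true r hr a)
    rw [map_evalRel, evalRel_eq_sum]
    refine Finset.sum_congr rfl fun w hw => ?_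
    obtain ⟨e, l, r', rfl⟩ := exists_node (hL2.trans (hL w hw).length_eq.ge)
    simp [subst, mark]
  | false =>
    rw [map_evalRel]
    have h1 : ∀ w ∈ r.support, (r w * (-1) ^ w.koszul P.deg (fun x => tdeg (a x))) •
        (markL (single (subst false w a)) : P.Words Y) = (L.map fun x =>
        if ∀ y ∈ L, y ≠ x → isPlain (a y) = true then
          (r w * (-1) ^ w.koszul P.deg (fun x => tdeg (a x))) • plug false w a x (mark (a x))
        else 0).sum := by
      intro w hw
      rw [markL_single, mark_subst w a ((hL w hw).nodup_iff.2 hLn), ((hL w hw).map _).sum_eq,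
        smul_list_sum]
      simp only [(hL w hw).mem_iff, smul_ite, smul_zero]
    rw [Finset.sum_congr rfl h1, sum_list_map_comm]
    refine listSum_mem _ _ _ fun x hx => ?_
    by_cases hc : ∀ y ∈ L, y ≠ x → isPlain (a y) = true
    · simp only [if_pos hc]
      have h2 : ∑ w ∈ r.support, (r w * (-1) ^ w.koszul P.deg (fun x => tdeg (a x))) •
          plug false w a x (mark (a x)) =
          (∑ w ∈ r.support, (r w * (-1) ^ w.koszul P.deg (fun x => tdeg (a x))) •
          plug false w a x : P.Words Y →ₗ[K] P.Words Y) (mark (a x)) := by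
        simp [LinearMap.sum_apply]
      rw [h2]
      refine mem_of_single _ _ _ fun t ht => ?_
      convert isRel_mem (IsRel.eval false r hr (Function.update a x t))
      have hupd : (fun y => tdeg (Function.update a x t y)) = fun y => tdeg (a y) := by
        funext y
        by_cases hy : y = x
        · subst hy; simpa using (mark_spec _ t ht).1
        · simp [Function.update_of_ne hy]
      rw [evalRel_eq_sum, LinearMap.sum_apply, hupd]
      simp
    · simp only [if_neg hc]
      simp

theorem contractL_evalRel (b : Bool) {r : BTree P.E (Fin 3) →₀ K} (hr : r ∈ P.rel)
    (a : Fin 3 → P.Tree Y) : contractL (evalRel b r a) ∈ relSpan P Y := by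
  obtain ⟨L, hLn, hL2, hL⟩ := exists_leaves hr
  have : contractL (evalRel b r a) = (if b then evalRel false r a else 0) +
      (-1 : K) ^ b.toNat • ∑ w ∈ r.support,
        (r w * (-1) ^ w.koszul P.deg (fun x => tdeg (a x))) • derSum contract b w a := by
    have h1 : (if b then evalRel false r a else 0 : P.Words Y) = ∑ w ∈ r.support,
        (r w * (-1) ^ w.koszul P.deg (fun x => tdeg (a x))) •
          if b then single (subst false w a) else 0 := by
      cases b
      · simp
      · simp only [if_true]; rw [evalRel_eq_sum]
    rw [map_evalRel, h1, Finset.smul_sum, ← Finset.sum_add_distrib]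
    refine Finset.sum_congr rfl fun w hw => ?_
    have hw2 := hL2.trans (hL w hw).length_eq.ge
    have hwn := (hL w hw).nodup_iff.2 hLn
    obtain ⟨e, l, r', rfl⟩ := exists_node hw2
    rw [contractL_single, contract_subst _ _ _ _ _ hwn, smul_add, smul_comm]
  rw [this]
  refine add_mem ?_ (Submodule.smul_mem _ _ (sum_derSum_mem _ b hr a fun x t ht =>
    (contract_spec _ t ht).2.1))
  split_ifs
  · exact isRel_mem (.eval false r hr a)
  · exact zero_mem _

theorem twistL_evalRel (b : Bool) {r : BTree P.E (Fin 3) →₀ K} (hr : r ∈ P.rel)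
    (a : Fin 3 → P.Tree Y) : twistL (evalRel b r a) ∈ relSpan P Y := by
  obtain ⟨L, hLn, hL2, hL⟩ := exists_leaves hr
  cases b with
  | false =>
    have : twistL (evalRel false r a) = ∑ w ∈ r.support,
        (r w * (-1) ^ w.koszul P.deg (fun x => tdeg (a x))) • derSum twist false w a := by
      rw [map_evalRel]
      refine Finset.sum_congr rfl fun w hw => ?_
      rw [twistL_single, derSum_eq isDer_twist _ _ ((hL w hw).nodup_iff.2 hLn)]
    rw [this]
    exact sum_derSum_mem _ false hr a fun x t ht => (twist_spec _ t ht).1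
  | true =>
    have : twistL (evalRel true r a) = markL (evalRel false r a) - ∑ w ∈ r.support,
        (r w * (-1) ^ w.koszul P.deg (fun x => tdeg (a x))) • derSum contract true w a := by
      rw [map_evalRel, map_evalRel, ← Finset.sum_sub_distrib]
      refine Finset.sum_congr rfl fun w hw => ?_
      have hw2 := hL2.trans (hL w hw).length_eq.ge
      have hwn := (hL w hw).nodup_iff.2 hLn
      obtain ⟨e, l, r', rfl⟩ := exists_node hw2
      rw [twistL_single, twist_subst_true _ _ _ _ hwn, smul_sub, markL_single]
    rw [this]
    exact sub_mem (markL_evalRel false hr a) (sum_derSum_mem _ true hr a fun x t ht =>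
      (contract_spec _ t ht).2.1)

theorem sgnL_relSpan {f : P.Words Y} (hf : f ∈ relSpan P Y) : sgnL f ∈ relSpan P Y := by
  induction hf using Submodule.span_induction with
  | zero => simp
  | add f g _ _ hf hg => rw [map_add]; exact add_mem hf hg
  | smul c f _ hf => rw [map_smul]; exact Submodule.smul_mem _ _ hf
  | mem f hf =>
    induction hf with
    | eval b r hr a =>
      obtain ⟨L, hLn, hL2, hL⟩ := exists_leaves hr
      obtain ⟨m, hm⟩ := P.rel_deg r hr
      have : sgnL (evalRel b r a) =
          (-1 : K) ^ (b.toNat + (m + (L.map fun x => tdeg (a x)).sum)) •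
            (evalRel b r a : P.Words Y) := by
        rw [map_evalRel, evalRel_eq_sum, Finset.smul_sum]
        refine Finset.sum_congr rfl fun w hw => ?_
        rw [sgnL_single, smul_comm]
        congr 2
        have h1 : tdeg (subst b w a) = b.toNat + tdeg (subst false w a) := by
          obtain ⟨e, l, r', rfl⟩ := exists_node (hL2.trans (hL w hw).length_eq.ge)
          simp only [subst, tdeg_node, Bool.toNat_false]
          ring
        rw [h1, tdeg_subst, hm w hw, ((hL w hw).map _).sum_eq]
      rw [this]
      exact Submodule.smul_mem _ _ (isRel_mem (.eval b r hr a))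
    | left a f t hf ih =>
      obtain ⟨b, e⟩ := a
      rw [sgnL_graft]
      exact Submodule.smul_mem _ _ (relSpan_graft_left _ ih _)
    | right a t f hf ih =>
      obtain ⟨b, e⟩ := a
      rw [sgnL_graft]
      exact Submodule.smul_mem _ _ (relSpan_graft_right _ ih _)

theorem plainL_relSpan {f : P.Words Y} (hf : f ∈ relSpan P Y) : plainL f ∈ relSpan P Y := by
  induction hf using Submodule.span_induction with
  | zero => simp
  | add f g _ _ hf hg => rw [map_add]; exact add_mem hf hg
  | smul c f _ hf => rw [map_smul]; exact Submodule.smul_mem _ _ hf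
  | mem f hf =>
    induction hf with
    | eval b r hr a =>
      obtain ⟨L, hLn, hL2, hL⟩ := exists_leaves hr
      cases b with
      | true =>
        have : plainL (evalRel true r a) = (0 : P.Words Y) := by
          rw [map_evalRel]
          refine Finset.sum_eq_zero fun w hw => ?_
          obtain ⟨e, l, r', rfl⟩ := exists_node (hL2.trans (hL w hw).length_eq.ge)
          simp [subst, isPlain]
        rw [this]
        exact zero_mem _
      | false =>
        by_cases hp : ∀ x ∈ L, isPlain (a x) = true
        · convert isRel_mem (IsRel.eval false r hr a)
          rw [map_evalRel, evalRel_eq_sum]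
          refine Finset.sum_congr rfl fun w hw => ?_
          rw [plainL_single, if_pos]
          rw [isPlain_subst]
          exact fun x hx => hp x ((hL w hw).mem_iff.1 hx)
        · have : plainL (evalRel false r a) = (0 : P.Words Y) := by
            rw [map_evalRel]
            refine Finset.sum_eq_zero fun w hw => ?_
            rw [plainL_single, if_neg, smul_zero]
            rw [isPlain_subst]
            exact fun h => hp fun x hx => h x ((hL w hw).mem_iff.2 hx)
          rw [this]
          exact zero_mem _
    | left a f t hf ih =>
      obtain ⟨b, e⟩ := a
      cases b
      · rw [plainL_graft_false]; exact relSpan_graft_left _ ih _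
      · rw [plainL_graft_true]; exact zero_mem _
    | right a t f hf ih =>
      obtain ⟨b, e⟩ := a
      cases b
      · rw [plainL_graft_false]; exact relSpan_graft_right _ ih _
      · rw [plainL_graft_true]; exact zero_mem _

theorem markL_relSpan {f : P.Words Y} (hf : f ∈ relSpan P Y) : markL f ∈ relSpan P Y := by
  induction hf using Submodule.span_induction with
  | zero => simp
  | add f g _ _ hf hg => rw [map_add]; exact add_mem hf hg
  | smul c f _ hf => rw [map_smul]; exact Submodule.smul_mem _ _ hf
  | mem f hf =>
    induction hf with
    | eval b r hr a => exact markL_evalRel b hr a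
    | left a f t hf ih =>
      obtain ⟨b, e⟩ := a
      cases b
      · rw [markL_graft_false]
        exact add_mem (relSpan_graft_left _ ih _)
          (relSpan_graft_left _ (plainL_relSpan (isRel_mem hf)) _)
      · rw [markL_graft_true]; exact relSpan_graft_left _ (isRel_mem hf) _
    | right a t f hf ih =>
      obtain ⟨b, e⟩ := a
      cases b
      · rw [markL_graft_false]
        exact add_mem (relSpan_graft_right _ (plainL_relSpan (isRel_mem hf)) _)
          (relSpan_graft_right _ ih _)
      · rw [markL_graft_true]; exact relSpan_graft_right _ (isRel_mem hf) _

theorem contractL_relSpan {f : P.Words Y} (hf : f ∈ relSpan P Y) :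
    contractL f ∈ relSpan P Y := by
  induction hf using Submodule.span_induction with
  | zero => simp
  | add f g _ _ hf hg => rw [map_add]; exact add_mem hf hg
  | smul c f _ hf => rw [map_smul]; exact Submodule.smul_mem _ _ hf
  | mem f hf =>
    induction hf with
    | eval b r hr a => exact contractL_evalRel b hr a
    | left a f t hf ih =>
      obtain ⟨b, e⟩ := a
      rw [contractL_graft]
      refine add_mem ?_ (Submodule.smul_mem _ _ (add_mem (relSpan_graft_left _ ih _)
        (relSpan_graft_left _ (sgnL_relSpan (isRel_mem hf)) _)))
      split_ifs
      · exact relSpan_graft_left _ (isRel_mem hf) _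
      · exact zero_mem _
    | right a t f hf ih =>
      obtain ⟨b, e⟩ := a
      rw [contractL_graft]
      refine add_mem ?_ (Submodule.smul_mem _ _ (add_mem (relSpan_graft_right _ (isRel_mem hf) _)
        (relSpan_graft_right _ ih _)))
      split_ifs
      · exact relSpan_graft_right _ (isRel_mem hf) _
      · exact zero_mem _

theorem twistL_relSpan {f : P.Words Y} (hf : f ∈ relSpan P Y) : twistL f ∈ relSpan P Y := by
  induction hf using Submodule.span_induction with
  | zero => simp
  | add f g _ _ hf hg => rw [map_add]; exact add_mem hf hg
  | smul c f _ hf => rw [map_smul]; exact Submodule.smul_mem _ _ hf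
  | mem f hf =>
    induction hf with
    | eval b r hr a => exact twistL_evalRel b hr a
    | left a f t hf ih =>
      obtain ⟨b, e⟩ := a
      have hf' := isRel_mem hf
      cases b
      · rw [twistL_graft_false]
        exact Submodule.smul_mem _ _ (add_mem (relSpan_graft_left _ ih _)
          (relSpan_graft_left _ (sgnL_relSpan hf') _))
      · rw [twistL_graft_true]
        exact add_mem (markL_relSpan (relSpan_graft_left _ hf' _)) (Submodule.smul_mem _ _
          (add_mem (relSpan_graft_left _ (contractL_relSpan hf') _)
          (relSpan_graft_left _ (sgnL_relSpan hf') _)))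
    | right a t f hf ih =>
      obtain ⟨b, e⟩ := a
      have hf' := isRel_mem hf
      cases b
      · rw [twistL_graft_false]
        exact Submodule.smul_mem _ _ (add_mem (relSpan_graft_right _ hf' _)
          (relSpan_graft_right _ ih _))
      · rw [twistL_graft_true]
        exact add_mem (markL_relSpan (relSpan_graft_right _ hf' _)) (Submodule.smul_mem _ _
          (add_mem (relSpan_graft_right _ hf' _)
          (relSpan_graft_right _ (contractL_relSpan hf') _)))

/-! ### The square of the differential -/

theorem mem_decSpan {f : P.Words Y} : f ∈ decSpan P Y ↔ ∀ t ∈ f.support, IsDecomposable t := by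
  have : decSpan P Y = Finsupp.supported K K {t : P.Tree Y | IsDecomposable t} := by
    rw [Finsupp.supported_eq_span_single, decSpan]
    congr 1
    ext f
    simp [eq_comm]
  rw [this, Finsupp.mem_supported]
  rfl

theorem hasSusp_of_not_isPlain {t : P.Tree Y} (h : IsBranch t) (h' : ¬ isPlain t = true) :
    HasSusp t := by
  induction t with
  | leaf x => simp [isPlain, IsBranch] at h h'; simp [h] at h'
  | node a l r hl hr =>
    obtain ⟨b, e⟩ := a
    cases b with
    | true => exact Or.inl rfl
    | false =>
      by_cases hp : isPlain l = true
      · by_cases hq : isPlain r = true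
        · simp [isPlain, hp, hq] at h'
        · exact Or.inr (Or.inr (hr h.2 hq))
      · exact Or.inr (Or.inl (hl h.1 hp))

theorem IsDecomposable.isWord {t : P.Tree Y} (h : IsDecomposable t) : IsWord t := by
  induction t with
  | leaf x => exact h.elim
  | node a l r hl hr =>
    obtain ⟨b, e⟩ := a
    cases b with
    | true => exact h.elim
    | false =>
      rcases h with h | h | h | h
      · exact Or.inl ⟨h.1, h.2.1⟩
      · exact Or.inr ⟨h.1, h.2.2⟩
      · exact Or.inl ⟨hl h.1, h.2⟩
      · exact Or.inr ⟨h.1, hr h.2⟩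

theorem twist_word_left (e : P.E) (l r : P.Tree Y) (h : isPlain r = true) :
    (twist (node (false, e) l r) : P.Words Y) =
      (-1 : K) ^ P.deg e • graft (false, e) (twist l) (single r) := by
  simp [twist, twist_plain h]

theorem twist_word_right (e : P.E) (l r : P.Tree Y) (h : isPlain l = true) :
    (twist (node (false, e) l r) : P.Words Y) =
      ((-1 : K) ^ P.deg e * (-1) ^ tdeg l) • graft (false, e) (single l) (twist r) := by
  simp [twist, twist_plain h, smul_smul]

theorem twist_decomposable {t : P.Tree Y} (h : IsDecomposable t) :
    ∀ t' ∈ (twist t : P.Words Y).support, IsDecomposable t' := by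
  induction t with
  | leaf x => exact h.elim
  | node a l r hl hr =>
    obtain ⟨b, e⟩ := a
    cases b with
    | true => exact h.elim
    | false =>
      rcases h with h | h | h | h
      · rw [twist_word_left e l r h.2.1]
        refine supp_smul _ (graft_supp _ (fun t ht => (twist_spec l t ht).2.2 h.1)
          (supp_single (C := fun t => t = r) rfl) ?_)
        rintro l' _ h1 rfl
        exact Or.inl ⟨h1, h.2⟩
      · rw [twist_word_right e l r h.1]
        refine supp_smul _ (graft_supp _ (supp_single (C := fun t => t = l) rfl)
          (fun t ht => (twist_spec r t ht).2.2 h.2.2) ?_)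
        rintro _ r' rfl h1
        exact Or.inr (Or.inl ⟨h.1, h.2.1, h1⟩)
      · rw [twist_word_left e l r h.2]
        refine supp_smul _ (graft_supp _ (hl h.1) (supp_single (C := fun t => t = r) rfl) ?_)
        rintro l' _ h1 rfl
        exact Or.inr (Or.inr (Or.inl ⟨h1, h.2⟩))
      · rw [twist_word_right e l r h.1]
        refine supp_smul _ (graft_supp _ (supp_single (C := fun t => t = l) rfl) (hr h.2) ?_)
        rintro _ r' rfl h1
        exact Or.inr (Or.inr (Or.inr ⟨h.1, h1⟩))

theorem twistL_relL {f : P.Words Y} (hf : f ∈ relL P Y) : twistL f ∈ relL P Y := by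
  obtain ⟨g, hg, h, hh, rfl⟩ := Submodule.mem_sup.1 hf
  rw [map_add]
  refine add_mem (Submodule.mem_sup_left (twistL_relSpan hg)) (Submodule.mem_sup_right ?_)
  refine mem_of_single _ _ _ fun t ht => ?_
  rw [twistL_single]
  exact mem_decSpan.2 (twist_decomposable (mem_decSpan.1 hh t ht))

theorem sgnL_sgnL (f : P.Words Y) : sgnL (sgnL f) = f := by
  have : (sgnL.comp sgnL : P.Words Y →ₗ[K] _) = LinearMap.id := words_ind fun t => by
    rw [LinearMap.comp_apply, sgnL_single, map_smul, sgnL_single, smul_smul, ← pow_add,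
      ← two_mul, pow_mul]
    simp
  exact congrArg (fun φ => φ f) this

theorem sgnL_of_lowersTo {n : ℕ} {f : P.Words Y} (h : LowersTo n f) :
    sgnL f = -((-1 : K) ^ n • f) := by
  suffices sgnL f + (-1 : K) ^ n • f ∈ (⊥ : Submodule K (P.Words Y)) from
    eq_neg_of_add_eq_zero_left this
  refine mem_of_single _ (sgnL + (-1 : K) ^ n • LinearMap.id) f fun t ht => ?_
  rw [Submodule.mem_bot, LinearMap.add_apply, sgnL_single, ← h t ht, LinearMap.smul_apply,
    LinearMap.id_apply, pow_succ, ← add_smul]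
  simp

theorem sgnL_contractL (f : P.Words Y) : sgnL (contractL f) = -contractL (sgnL f) := by
  have : (sgnL.comp contractL : P.Words Y →ₗ[K] P.Words Y) =
      -(contractL.comp sgnL : P.Words Y →ₗ[K] P.Words Y) :=
    words_ind fun t => by
      rw [LinearMap.comp_apply, LinearMap.neg_apply, LinearMap.comp_apply, contractL_single,
        sgnL_single, map_smul, contractL_single]
      exact sgnL_of_lowersTo fun t' ht' => (contract_spec t t' ht').2.1
  exact congrArg (fun φ => φ f) this

theorem contract_node (b : Bool) (e : P.E) (l r : P.Tree Y) :
    (contract (node (b, e) l r) : P.Words Y) =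
      (if b then graft (false, e) (single l) (single r) else 0) +
      (-1 : K) ^ (b.toNat + P.deg e) • (graft (b, e) (contract l) (single r) +
        graft (b, e) (sgnL (single l)) (contract r)) := by
  rw [contract, sgnL_single, map_smul, LinearMap.smul_apply, graft_single_single]

theorem neg_one_sq_smul (n : ℕ) (f : P.Words Y) : (-1 : K) ^ n • (-1 : K) ^ n • f = f := by
  rw [smul_smul, ← pow_add, ← two_mul, pow_mul]
  simp

theorem contractL_contract (t : P.Tree Y) : contractL (contract t : P.Words Y) = 0 := by
  induction t with
  | leaf x => simp [contract]
  | node a l r hl hr =>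
    obtain ⟨b, e⟩ := a
    rw [contract_node]
    cases b with
    | false =>
      simp [contractL_graft, sgnL_contractL, sgnL_sgnL, -sgnL_single, ← contractL_single]
      simp [hl, hr]
    | true =>
      simp [contractL_graft, hl, hr, -sgnL_single, pow_add]
      rw [← contractL_single l, sgnL_contractL]
      simp [-sgnL_single, -contractL_single]
      module

theorem isBranch_mark_twist {t : P.Tree Y} (h : IsBranch t) :
    twistL (mark t) - markL (contract t) ∈ decSpan P Y := by
  induction t with
  | leaf x => simp [mark, contract, twist]
  | node a l r hl hr =>
    obtain ⟨b, e⟩ := a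
    cases b with
    | true =>
      have : twistL (mark (node (true, e) l r)) - markL (contract (node (true, e) l r)) =
          (0 : P.Words Y) := by
        rw [mark, twistL_single, contract, twist]
        simp [markL_graft_true]
      rw [this]
      exact zero_mem _
    | false =>
      have hp : ∀ t : P.Tree Y, twistL (plainL (single t) : P.Words Y) = 0 := fun t => by
        rw [plainL_single]
        split_ifs with h
        · rw [twistL_single, twist_plain h]
        · simp
      have hs : ∀ t : P.Tree Y, plainL (sgnL (single t)) =
          (sgnL (plainL (single t)) : P.Words Y) := fun t => by
        rw [sgnL_single, map_smul, plainL_single]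
        split_ifs with h
        · rw [sgnL_single]
        · simp
      have key : twistL (mark (node (false, e) l r)) -
          markL (contract (node (false, e) l r)) = (-1 : K) ^ P.deg e •
          (graft (false, e) (twistL (mark l) - markL (contract l)) (plainL (single r)) +
          graft (false, e) (sgnL (plainL (single l))) (twistL (mark r) - markL (contract r)) -
          graft (false, e) (plainL (contract l)) (mark r) -
          (-1 : K) ^ tdeg l • graft (false, e) (mark l) (plainL (contract r) : P.Words Y)) := by
        rw [← markL_single (node (false, e) l r), ← graft_single_single, markL_graft_false,
          contract_node]
        simp only [map_add, twistL_graft_false, hp, map_smul, markL_graft_false, markL_single,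
          map_zero, hs, Bool.false_eq_true, if_false, Bool.toNat_false, zero_add, map_sub,
          LinearMap.sub_apply, LinearMap.zero_apply, add_zero]
        rw [sgnL_single l, map_smul, map_smul, LinearMap.smul_apply, markL_single]
        module
      have hP : ∀ (t : P.Tree Y), ∀ t' ∈ (plainL (single t) : P.Words Y).support,
          isPlain t' = true := fun t => by
        rw [plainL_single]
        exact supp_ite _ fun h => supp_single h
      have hS : ∀ (t : P.Tree Y), ∀ t' ∈ (sgnL (plainL (single t)) : P.Words Y).support,
          isPlain t' = true := fun t => by
        rw [← hs, sgnL_single, map_smul]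
        exact supp_smul _ (hP t)
      have hC : ∀ (t : P.Tree Y), ∀ t' ∈ (plainL (contract t) : P.Words Y).support,
          isPlain t' = true ∧ t'.IsNode := fun t => by
        suffices plainL (contract t) ∈
            Finsupp.supported K K {t' : P.Tree Y | isPlain t' = true ∧ t'.IsNode} from
          fun t ht => (Finsupp.mem_supported K _).1 this ht
        refine mem_of_single _ _ _ fun t' ht' => ?_
        rw [plainL_single]
        split_ifs with h
        · exact Finsupp.single_mem_supported K _ ⟨h, (contract_spec t t' ht').1⟩
        · exact zero_mem _
      rw [key]
      refine Submodule.smul_mem _ _ (sub_mem (sub_mem (add_mem ?_ ?_) ?_)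
        (Submodule.smul_mem _ _ ?_)) <;> rw [mem_decSpan]
      · exact graft_supp _ (mem_decSpan.1 (hl h.1)) (hP r) fun l r h1 h2 =>
          Or.inr (Or.inr (Or.inl ⟨h1, h2⟩))
      · exact graft_supp _ (hS l) (mem_decSpan.1 (hr h.2)) fun l r h1 h2 =>
          Or.inr (Or.inr (Or.inr ⟨h1, h2⟩))
      · exact graft_supp _ (hC l) (fun t ht => (mark_spec r t ht).2.2 h.2) fun l r h1 h2 =>
          Or.inr (Or.inl ⟨h1.1, h1.2, h2⟩)
      · exact graft_supp _ (fun t ht => (mark_spec l t ht).2.2 h.1) (hC r) fun l r h1 h2 =>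
          Or.inl ⟨h1, h2⟩

theorem twistL_twist {t : P.Tree Y} (h : IsWord t) : twistL (twist t) ∈ decSpan P Y := by
  induction t with
  | leaf x => simp [twist]
  | node a l r hl hr =>
    obtain ⟨b, e⟩ := a
    cases b with
    | true =>
      have key : twistL (twist (node (true, e) l r)) =
          (twistL (mark (node (false, e) l r)) - markL (contract (node (false, e) l r)) :
            P.Words Y) := by
        have h1 : (twist (node (true, e) l r) : P.Words Y) = mark (node (false, e) l r) +
            (-1 : K) ^ (1 + P.deg e) • (graft (true, e) (contract l) (single r) +
              graft (true, e) (sgnL (single l)) (contract r)) := by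
          rw [twist, sgnL_single, map_smul, LinearMap.smul_apply]
        have h2 : sgnL (contract l) = (-contractL (sgnL (single l)) : P.Words Y) := by
          rw [← sgnL_contractL, contractL_single]
        rw [h1, contract_node]
        simp only [map_add, map_smul, twistL_graft_true, contractL_contract, contractL_single,
          map_zero, LinearMap.zero_apply, zero_add, add_zero, h2, map_neg, LinearMap.neg_apply,
          Bool.false_eq_true, if_false, Bool.toNat_false, pow_add, pow_one]
        module
      rw [key]
      exact isBranch_mark_twist h
    | false =>
      rcases h with h | h
      · rw [twist_word_left e l r h.2, map_smul, twistL_graft_false, twistL_single,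
          twist_plain h.2, map_zero, add_zero]
        refine Submodule.smul_mem _ _ (Submodule.smul_mem _ _ (mem_decSpan.2 ?_))
        refine graft_supp _ (mem_decSpan.1 (hl h.1)) (supp_single (C := fun t => t = r) rfl) ?_
        rintro l' _ h1 rfl
        exact Or.inr (Or.inr (Or.inl ⟨h1, h.2⟩))
      · rw [twist_word_right e l r h.1, map_smul, twistL_graft_false, twistL_single,
          twist_plain h.1, map_zero, LinearMap.zero_apply, zero_add, sgnL_single, map_smul,
          LinearMap.smul_apply]
        refine Submodule.smul_mem _ _ (Submodule.smul_mem _ _ (Submodule.smul_mem _ _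
          (mem_decSpan.2 ?_)))
        refine graft_supp _ (supp_single (C := fun t => t = l) rfl) (mem_decSpan.1 (hr h.2)) ?_
        rintro _ r' rfl h1
        exact Or.inr (Or.inr (Or.inr ⟨h.1, h1⟩))

/-! ### The projection onto the Kähler differentials -/

theorem susp_mem {f : P.Words Y} (h : ∀ t ∈ f.support, HasSusp t) : f ∈ omegaSpan P Y := by
  refine Submodule.mem_sup_left ?_
  refine mem_of_single _ LinearMap.id f fun t ht => Submodule.subset_span ⟨t, h t ht, rfl⟩

theorem mark_hasSusp {t : P.Tree Y} (h : HasSusp t) :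
    ∀ t' ∈ (mark t : P.Words Y).support, HasSusp t' := by
  induction t with
  | leaf x => exact h.elim
  | node a l r hl hr =>
    obtain ⟨b, e⟩ := a
    cases b with
    | true => exact supp_single (Or.inl rfl)
    | false =>
      refine supp_add (supp_ite _ fun hp => ?_) (supp_ite _ fun hp => ?_)
      · have hs : HasSusp l := by
          rcases h with h | h | h
          · simp at h
          · exact h
          · exact absurd h (isPlain.not_hasSusp hp)
        exact graft_supp (B := fun _ => True) _ (hl hs) (by simp)
          fun l r h1 _ => Or.inr (Or.inl h1)
      · have hs : HasSusp r := by
          rcases h with h | h | h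
          · simp at h
          · exact absurd h (isPlain.not_hasSusp hp)
          · exact h
        exact graft_supp (A := fun _ => True) _ (by simp) (hr hs)
          fun l r _ h1 => Or.inr (Or.inr h1)

theorem omegaSpan_graft_left (e : P.E) {f : P.Words Y} (hf : f ∈ omegaSpan P Y) {q : P.Tree Y}
    (hq : isPlain q = true) : graft (false, e) f (single q) ∈ omegaSpan P Y := by
  obtain ⟨g, hg, h, hh, rfl⟩ := Submodule.mem_sup.1 hf
  rw [map_add, LinearMap.add_apply]
  refine add_mem ?_ (Submodule.mem_sup_right ?_) <;> clear hf
  · clear hh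
    induction hg using Submodule.span_induction with
    | mem g hg =>
      obtain ⟨t, ht, rfl⟩ := hg
      rw [graft_single_single]
      exact susp_mem (supp_single (Or.inr (Or.inl ht)))
    | zero => simp
    | add f g _ _ hf hg => rw [map_add, LinearMap.add_apply]; exact add_mem hf hg
    | smul c f _ hf => rw [map_smul, LinearMap.smul_apply]; exact Submodule.smul_mem _ _ hf
  · induction hh using Submodule.span_induction with
    | mem g hg => exact Submodule.subset_span (.left e g q hq hg)
    | zero => simp
    | add f g _ _ hf hg => rw [map_add, LinearMap.add_apply]; exact add_mem hf hg
    | smul c f _ hf => rw [map_smul, LinearMap.smul_apply]; exact Submodule.smul_mem _ _ hf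

theorem omegaSpan_graft_right (e : P.E) {f : P.Words Y} (hf : f ∈ omegaSpan P Y) {q : P.Tree Y}
    (hq : isPlain q = true) : graft (false, e) (single q) f ∈ omegaSpan P Y := by
  obtain ⟨g, hg, h, hh, rfl⟩ := Submodule.mem_sup.1 hf
  rw [map_add]
  refine add_mem ?_ (Submodule.mem_sup_right ?_) <;> clear hf
  · clear hh
    induction hg using Submodule.span_induction with
    | mem g hg =>
      obtain ⟨t, ht, rfl⟩ := hg
      rw [graft_single_single]
      exact susp_mem (supp_single (Or.inr (Or.inr ht)))
    | zero => simp
    | add f g _ _ hf hg => rw [map_add]; exact add_mem hf hg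
    | smul c f _ hf => rw [map_smul]; exact Submodule.smul_mem _ _ hf
  · induction hh using Submodule.span_induction with
    | mem g hg => exact Submodule.subset_span (.right e q g hq hg)
    | zero => simp
    | add f g _ _ hf hg => rw [map_add]; exact add_mem hf hg
    | smul c f _ hf => rw [map_smul]; exact Submodule.smul_mem _ _ hf

theorem twist_mem_omegaSpan {t : P.Tree Y} (h : IsWord t) : twist t ∈ omegaSpan P Y := by
  induction t with
  | leaf x => simp [twist]
  | node a l r hl hr =>
    obtain ⟨b, e⟩ := a
    cases b with
    | true =>
      rw [twist]
      refine add_mem ?_ (Submodule.smul_mem _ _ (susp_mem (supp_add ?_ (supp_smul _ ?_))))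
      · by_cases hp : isPlain (node (false, e) l r) = true
        · exact Submodule.mem_sup_right (Submodule.subset_span (.base _ hp trivial))
        · exact susp_mem (mark_hasSusp (hasSusp_of_not_isPlain (t := node (false, e) l r) h hp))
      · exact graft_supp (A := fun _ => True) (B := fun _ => True) _ (by simp) (by simp)
          fun l r _ _ => Or.inl rfl
      · exact graft_supp (A := fun _ => True) (B := fun _ => True) _ (by simp) (by simp)
          fun l r _ _ => Or.inl rfl
    | false =>
      rcases h with h | h
      · rw [twist_word_left e l r h.2]
        exact Submodule.smul_mem _ _ (omegaSpan_graft_left e (hl h.1) h.2)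
      · rw [twist_word_right e l r h.1]
        exact Submodule.smul_mem _ _ (omegaSpan_graft_right e (hr h.2) h.1)

theorem twist_mem_relOmega {f : P.Words Y} (h : ∀ t ∈ f.support, IsWord t) :
    twistL f ∈ relOmega P Y :=
  mem_of_single _ _ _ fun t ht => by
    rw [twistL_single]
    exact Submodule.mem_sup_right (twist_mem_omegaSpan (h t ht))

/-! ### The module of obstructions -/

variable (P)

/-- The linear combinations of words of degree `k` in which each of the `n` labels occurs exactly
once. -/
def wordSpan (n k : ℕ) : Submodule K (P.Words (Fin n)) :=
  Finsupp.supported K K {t | IsWord t ∧ (labels t).Perm (List.finRange n) ∧ tdeg t = k}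

/-- The degree `k` part of the arity `n` component of `L̄_𝒫 = L_𝒫 ∘_𝒫 I`. -/
abbrev LBar (n k : ℕ) : Type _ := (P.wordSpan n k).map (relL P (Fin n)).mkQ

/-- The degree `k` part of the arity `n` component of `Ω̄_𝒫 = Ω_𝒫 ∘_𝒫 I`. -/
abbrev OmegaBar (n k : ℕ) : Type _ := (P.wordSpan n k).map (relOmega P (Fin n)).mkQ

theorem twistL_wordSpan {n k : ℕ} {f : P.Words (Fin n)} (hf : f ∈ P.wordSpan n (k + 1)) :
    twistL f ∈ P.wordSpan n k := by
  refine mem_of_single _ _ _ fun t ht => ?_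
  obtain ⟨h1, h2, h3⟩ := (Finsupp.mem_supported K _).1 hf ht
  rw [twistL_single]
  refine (Finsupp.mem_supported K _).2 fun t' ht' => ?_
  obtain ⟨h4, h5, h6⟩ := twist_spec t t' ht'
  exact ⟨h6 h1, h5 ▸ h2, by omega⟩

/-- The differential of `L̄_𝒫`. -/
noncomputable def dL (n k : ℕ) : P.LBar n (k + 1) →ₗ[K] P.LBar n k :=
  LinearMap.restrict ((relL P (Fin n)).mapQ (relL P (Fin n))
    (-(twistL : P.Words (Fin n) →ₗ[K] P.Words (Fin n))) fun _ hf =>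
      neg_mem (twistL_relL hf)) <| by
    rintro _ ⟨f, hf, rfl⟩
    exact ⟨_, neg_mem (P.twistL_wordSpan hf), rfl⟩

/-- The projection of `L̄_𝒫` onto `Ω̄_𝒫`. -/
noncomputable def piBar (n k : ℕ) : P.LBar n k →ₗ[K] P.OmegaBar n k :=
  LinearMap.restrict (Submodule.factor (show relL P (Fin n) ≤ relOmega P (Fin n) from
    le_sup_left)) <| by
    rintro _ ⟨f, hf, rfl⟩
    exact ⟨f, hf, rfl⟩

/-- The degree `k` part of the arity `n` component of the module of obstructions
`𝕆_𝒫 = ker (L̄_𝒫 → Ω̄_𝒫)`. -/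
abbrev Obstruction (n k : ℕ) : Type _ := LinearMap.ker (P.piBar n k)

theorem piBar_surjective (n k : ℕ) : Function.Surjective (P.piBar n k) := by
  rintro ⟨_, f, hf, rfl⟩
  exact ⟨⟨_, f, hf, rfl⟩, rfl⟩

theorem piBar_dL (n k : ℕ) (x : P.LBar n (k + 1)) : P.piBar n k (P.dL n k x) = 0 := by
  obtain ⟨_, f, hf, rfl⟩ := x
  refine Subtype.ext ((Submodule.Quotient.mk_eq_zero _).2 (neg_mem (twist_mem_relOmega ?_)))
  exact fun t ht => ((Finsupp.mem_supported K _).1 hf ht).1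

theorem dL_dL (n k : ℕ) (x : P.LBar n (k + 1 + 1)) : P.dL n k (P.dL n (k + 1) x) = 0 := by
  obtain ⟨_, f, hf, rfl⟩ := x
  refine Subtype.ext ((Submodule.Quotient.mk_eq_zero _).2 (Submodule.mem_sup_right ?_))
  change -twistL (-twistL f) ∈ decSpan P (Fin n)
  rw [map_neg, neg_neg]
  refine mem_of_single _ (twistL.comp twistL) f fun t ht => ?_
  rw [LinearMap.comp_apply, twistL_single]
  exact twistL_twist ((Finsupp.mem_supported K _).1 hf ht).1

/-- The differential of the module of obstructions. -/
noncomputable def dObstruction (n k : ℕ) : P.Obstruction n (k + 1) →ₗ[K] P.Obstruction n k :=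
  LinearMap.restrict (P.dL n k) fun x _ => P.piBar_dL n k x

/-- The arity `n` component of the module of obstructions `𝕆_𝒫`, as a chain complex. -/
noncomputable def obstructionComplex (n : ℕ) : ChainComplex (ModuleCat K) ℕ :=
  ChainComplex.of (fun k => ModuleCat.of K (P.Obstruction n k))
    (fun k => ModuleCat.ofHom (P.dObstruction n k)) fun k =>
      ModuleCat.hom_ext (LinearMap.ext fun x => Subtype.ext (P.dL_dL n k x.1))

end BinaryPresentation

/-! ### The operads of Perm, Poisson and Gerstenhaber algebras -/

section Examples

variable (K : Type*) [Field K]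

theorem forall_single {N : Type} {C : BTree N (Fin 3) → Prop} {w : BTree N (Fin 3)} (h : C w) :
    ∀ v ∈ (Finsupp.single w (1 : K)).support, C v := fun v hv => by
  have := Finset.mem_singleton.1 (Finsupp.support_single_subset hv)
  exact this ▸ h

variable {K} in
theorem forall_add {N : Type} {C : BTree N (Fin 3) → Prop} {f g : BTree N (Fin 3) →₀ K}
    (hf : ∀ v ∈ f.support, C v) (hg : ∀ v ∈ g.support, C v) : ∀ v ∈ (f + g).support, C v := by
  classical
  exact fun v hv => (Finset.mem_union.1 (Finsupp.support_add hv)).elim (hf v) (hg v)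

variable {K} in
theorem forall_sub {N : Type} {C : BTree N (Fin 3) → Prop} {f g : BTree N (Fin 3) →₀ K}
    (hf : ∀ v ∈ f.support, C v) (hg : ∀ v ∈ g.support, C v) : ∀ v ∈ (f - g).support, C v := by
  classical
  exact fun v hv => (Finset.mem_union.1 (Finsupp.support_sub hv)).elim (hf v) (hg v)

variable {K} in
theorem forall_smul {N : Type} {C : BTree N (Fin 3) → Prop} {f : BTree N (Fin 3) →₀ K} (c : K)
    (hf : ∀ v ∈ f.support, C v) : ∀ v ∈ (c • f).support, C v :=
  fun v hv => hf v (Finsupp.support_smul hv)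

/-- The monomial `w`, as a linear combination. -/
noncomputable abbrev mon {N : Type} (w : BTree N (Fin 3)) : BTree N (Fin 3) →₀ K :=
  Finsupp.single w 1

/-- The product of a Perm algebra. -/
abbrev permMul (l r : BTree Unit (Fin 3)) : BTree Unit (Fin 3) := node () l r

/-- The operad of Perm algebras: one operation without symmetry, such that
`(x₀ x₁) x₂ = x₀ (x₁ x₂) = x₀ (x₂ x₁)`. -/
noncomputable def perm : BinaryPresentation K where
  E := Unit
  deg _ := 0
  rel := {mon K (permMul (permMul (leaf 0) (leaf 1)) (leaf 2)) -
        mon K (permMul (leaf 0) (permMul (leaf 1) (leaf 2))),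
      mon K (permMul (leaf 0) (permMul (leaf 1) (leaf 2))) -
        mon K (permMul (leaf 0) (permMul (leaf 2) (leaf 1)))}
  rel_leaves := by
    rintro r (rfl | rfl) <;> right
    all_goals
      refine forall_sub (forall_single K ?_) (forall_single K ?_) <;> simp only [leaves] <;> decide
  rel_deg := by
    rintro r (rfl | rfl) <;> refine ⟨0, ?_⟩
    all_goals exact forall_sub (forall_single K rfl) (forall_single K rfl)

/-- The operations of Poisson and Gerstenhaber algebras. -/
inductive PoissonOp : Type
  | mul : PoissonOp
  | bracket : PoissonOp

/-- The commutative product. -/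
abbrev poissonMul (l r : BTree PoissonOp (Fin 3)) : BTree PoissonOp (Fin 3) := node .mul l r

/-- The bracket. -/
abbrev poissonBr (l r : BTree PoissonOp (Fin 3)) : BTree PoissonOp (Fin 3) := node .bracket l r

/-- The relations of Poisson algebras (`ε = -1`) and of Gerstenhaber algebras (`ε = 1`):
`x₀ x₁ = x₁ x₀`, `[x₀, x₁] = ε [x₁, x₀]`, `(x₀ x₁) x₂ = x₀ (x₁ x₂)`,
`[[x₀, x₁], x₂] + [[x₁, x₂], x₀] + [[x₂, x₀], x₁] = 0` and
`[x₀ x₁, x₂] = x₀ [x₁, x₂] + [x₀, x₂] x₁`. -/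
def poissonRel (ε : K) : Set (BTree PoissonOp (Fin 3) →₀ K) :=
  {mon K (poissonMul (leaf 0) (leaf 1)) - mon K (poissonMul (leaf 1) (leaf 0)),
    mon K (poissonBr (leaf 0) (leaf 1)) - ε • mon K (poissonBr (leaf 1) (leaf 0)),
    mon K (poissonMul (poissonMul (leaf 0) (leaf 1)) (leaf 2)) -
      mon K (poissonMul (leaf 0) (poissonMul (leaf 1) (leaf 2))),
    mon K (poissonBr (poissonBr (leaf 0) (leaf 1)) (leaf 2)) +
      mon K (poissonBr (poissonBr (leaf 1) (leaf 2)) (leaf 0)) +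
      mon K (poissonBr (poissonBr (leaf 2) (leaf 0)) (leaf 1)),
    mon K (poissonBr (poissonMul (leaf 0) (leaf 1)) (leaf 2)) -
      mon K (poissonMul (leaf 0) (poissonBr (leaf 1) (leaf 2))) -
      mon K (poissonMul (poissonBr (leaf 0) (leaf 2)) (leaf 1))}

theorem poissonRel_leaves (ε : K) : ∀ r ∈ poissonRel K ε,
    (∀ w ∈ r.support, w.leaves.Perm [0, 1]) ∨ (∀ w ∈ r.support, w.leaves.Perm [0, 1, 2]) := by
  rintro r (rfl | rfl | rfl | rfl | rfl)
  · left
    refine forall_sub (forall_single K ?_) (forall_single K ?_) <;> simp only [leaves] <;> decide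
  · left
    refine forall_sub (forall_single K ?_) (forall_smul _ (forall_single K ?_)) <;>
      simp only [leaves] <;> decide
  · right
    refine forall_sub (forall_single K ?_) (forall_single K ?_) <;> simp only [leaves] <;> decide
  · right
    refine forall_add (forall_add (forall_single K ?_) (forall_single K ?_))
      (forall_single K ?_) <;> simp only [leaves] <;> decide
  · right
    refine forall_sub (forall_sub (forall_single K ?_) (forall_single K ?_))
      (forall_single K ?_) <;> simp only [leaves] <;> decide

/-- The vertices of a relation of Poisson algebras are the same in all its monomials. -/
theorem poissonRel_deg (ε : K) (d : PoissonOp → ℕ) : ∀ r ∈ poissonRel K ε,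
    ∃ m, ∀ w ∈ r.support, w.vdeg d = m := by
  rintro r (rfl | rfl | rfl | rfl | rfl)
  · exact ⟨_, forall_sub (forall_single K rfl) (forall_single K rfl)⟩
  · exact ⟨_, forall_sub (forall_single K rfl) (forall_smul _ (forall_single K rfl))⟩
  · refine ⟨d .mul + d .mul, forall_sub (forall_single K ?_) (forall_single K ?_)⟩ <;>
      simp [vdeg]
  · exact ⟨_, forall_add (forall_add (forall_single K rfl) (forall_single K rfl))
      (forall_single K rfl)⟩
  · refine ⟨d .mul + d .bracket, forall_sub (forall_sub (forall_single K ?_)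
      (forall_single K ?_)) (forall_single K ?_)⟩ <;> simp [vdeg, add_comm]

/-- The operad of Poisson algebras. -/
noncomputable def poisson : BinaryPresentation K where
  E := PoissonOp
  deg _ := 0
  rel := poissonRel K (-1)
  rel_leaves := poissonRel_leaves K (-1)
  rel_deg := poissonRel_deg K (-1) _

/-- The degree of the operations of Gerstenhaber algebras: the bracket has degree `1`. -/
def gerstDeg : PoissonOp → ℕ
  | .mul => 0
  | .bracket => 1

/-- The operad of Gerstenhaber algebras. -/
noncomputable def gerst : BinaryPresentation K where
  E := PoissonOp
  deg := gerstDeg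
  rel := poissonRel K 1
  rel_leaves := poissonRel_leaves K 1
  rel_deg := poissonRel_deg K 1 _

end Examples

end OperadObstruction

namespace OperadObstruction

open BTree

/-! Write `xy` for the product `m` of degree `0`, and `dx` for a marked leaf. In arity `3` the
nonzero class is that of the word `x₀ · s(x₁x₂)`, which is `obstructionTree m`. Up to sign its
boundary is `x₀(dx₁ x₂) + x₀(x₁ dx₂)`, by the Leibniz rule. The relations `(xy)z = x(yz) = x(zy)`
rewrite the two terms as `(x₀x₂)dx₁` and `(x₀x₁)dx₂`. In both of them an operation is composed at an
input of the root other than the distinguished one, and such words are zero in `L̄`. So the word is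
a cycle of `L̄`. It has a suspension, hence it is zero in `Ω̄` and lies in the module of
obstructions.

It remains to see that this cycle is not a boundary, and a linear form detects it. Let each
generating operation `e` act on polynomials in one variable `t` without constant term as `c e` times
the product. Forgetting suspensions and marks and evaluating a tree at `t` gives `weight c` times a
power of `t` whose exponent is the number of leaves. The form used is the weight on trees with three
leaves and degree `1`, and zero on all other trees. It has three properties.

It vanishes on the relations of the operad (`form_relSpan`), because these hold in the polynomial
algebra. Operations of nonzero degree have weight `0`, and in total degree at most `1` no Koszul
sign can appear.

It vanishes on the decomposable words (`form_decSpan`). In positive degree and with nonzero weight,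
such a word contains a suspended operation and a further operation at another input, hence at least
four leaves.

It vanishes on the boundaries (`form_twistL`). A word of degree `2` and nonzero weight has exactly
two suspensions. Its boundary is the difference of the two trees obtained by removing one of them,
and these have the same weight, the same number of leaves and the same degree.

On the cycle the value is `(c m)²`, which is not zero. The argument needs only the two relations of
`m` and the weight `c` (`homology_obstructionComplex_not_isZero`). For Perm the weight is `1`. For
Poisson and Gerstenhaber `m` is the commutative product, with weight `1`, and the bracket has weight
`0`. -/

/-- The product of the weights of the vertices. -/
def BTree.weight {K : Type*} {N X : Type} [Field K] (c : N → K) : BTree N X → K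
  | leaf _ => 1
  | node a l r => c a * weight c l * weight c r

/-! ### Leaf counts, degrees and Koszul signs of weighted trees -/

theorem BTree.length_leaves_pos {N X : Type} (t : BTree N X) : 0 < t.leaves.length := by
  induction t with
  | leaf x => simp [leaves]
  | node a l r hl hr => simp only [leaves, List.length_append]; omega

theorem BTree.two_le_length_leaves {N X : Type} {t : BTree N X} (h : t.IsNode) :
    2 ≤ t.leaves.length := by
  cases t with
  | leaf x => exact h.elim
  | node a l r =>
    have := l.length_leaves_pos
    have := r.length_leaves_pos
    simp only [leaves, List.length_append]; omega

/-- A nonzero product has only nonzero factors, so every vertex is an operation of degree `0`. Trees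
containing an operation of nonzero degree are thus invisible to the weight, and so are the signs
they would cause. -/
theorem BTree.vdeg_eq_zero_of_weight {K : Type*} {N X : Type} [Field K] {c : N → K} {d : N → ℕ}
    (hc : ∀ e, c e ≠ 0 → d e = 0) {t : BTree N X} (h : t.weight c ≠ 0) : t.vdeg d = 0 := by
  induction t with
  | leaf x => rfl
  | node a l r hl hr =>
    simp only [weight, mul_ne_zero_iff] at h
    simp [vdeg, hc _ h.1.1, hl h.1.2, hr h.2]

/-- Each term of the sign exponent is a product of the degrees of two distinct objects. The vertices
have degree `0`, and at most one leaf has nonzero degree, so every such product has a zero factor.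
-/
theorem BTree.koszul_eq_zero {K : Type*} {N : Type} [Field K] {c : N → K} {d : N → ℕ}
    (hc : ∀ e, c e ≠ 0 → d e = 0) {δ : Fin 3 → ℕ} {w : BTree N (Fin 3)} (h : w.weight c ≠ 0)
    (hδ : (w.leaves.map δ).sum ≤ 1) : w.koszul d δ = 0 := by
  induction w with
  | leaf x => rfl
  | node a l r hl hr =>
    simp only [weight, mul_ne_zero_iff] at h
    simp only [leaves, List.map_append, List.sum_append] at hδ
    have key : (l.leaves.map fun x =>
        (r.leaves.map fun y => if y < x then δ x * δ y else 0).sum).sum = 0 := by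
      refine List.sum_eq_zero fun n hn => ?_
      obtain ⟨x, hx, rfl⟩ := List.mem_map.1 hn
      refine List.sum_eq_zero fun m hm => ?_
      obtain ⟨y, hy, rfl⟩ := List.mem_map.1 hm
      have h1 : δ x ≤ (l.leaves.map δ).sum := List.le_sum_of_mem (List.mem_map_of_mem hx)
      have h2 : δ y ≤ (r.leaves.map δ).sum := List.le_sum_of_mem (List.mem_map_of_mem hy)
      have h3 : δ x = 0 ∨ δ y = 0 := by omega
      rcases h3 with h3 | h3 <;> simp [h3]
    simp only [koszul, key, hl h.1.2 (by omega), hr h.2 (by omega),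
      vdeg_eq_zero_of_weight hc h.2, mul_zero, add_zero]

/-! ### The linear form given by weight, number of leaves and degree -/

namespace BinaryPresentation

variable {K : Type*} [Field K] {P : BinaryPresentation K} {Y : Type}

/-- The weight of a tree with suspended and marked vertices. -/
abbrev weight (c : P.E → K) (t : P.Tree Y) : K := BTree.weight (fun a => c a.2) t

/-- The linear form that sends a tree of weight `w` with `n` leaves and of degree `k` to
`w * G n k`. -/
noncomputable def form (c : P.E → K) (G : ℕ → ℕ → K) : P.Words Y →ₗ[K] K :=
  Finsupp.linearCombination K fun t => weight c t * G t.leaves.length (tdeg t)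

@[simp] theorem form_single (c : P.E → K) (G : ℕ → ℕ → K) (t : P.Tree Y) :
    form c G (single t) = weight c t * G t.leaves.length (tdeg t) := by
  simp [form]

/-- Grafting a fixed tree only translates the two arguments of `G`. This is why the forms are
defined for an arbitrary `G`: inductions on trees are carried out for all `G` at once. -/
theorem form_graft_left (c : P.E → K) (G : ℕ → ℕ → K) (a : Bool × P.E) (f : P.Words Y)
    (t : P.Tree Y) : form c G (graft a f (single t)) = c a.2 * weight c t *
      form c (fun n k => G (n + t.leaves.length) (a.1.toNat + P.deg a.2 + k + tdeg t)) f := by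
  have : (form c G).comp ((graft a).flip (single t)) = (c a.2 * weight c t) •
      form c (fun n k => G (n + t.leaves.length) (a.1.toNat + P.deg a.2 + k + tdeg t)) := by
    obtain ⟨b, e⟩ := a
    ext s
    have := graft_single_single (b, e) s t
    simp only [LinearMap.comp_apply, LinearMap.flip_apply, Finsupp.lsingle_apply, this,
      LinearMap.smul_apply, form_single, tdeg_node, leaves, List.length_append, smul_eq_mul,
      weight, BTree.weight]
    ring
  exact congrArg (fun φ => φ f) this

theorem form_graft_right (c : P.E → K) (G : ℕ → ℕ → K) (a : Bool × P.E) (f : P.Words Y)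
    (t : P.Tree Y) : form c G (graft a (single t) f) = c a.2 * weight c t *
      form c (fun n k => G (t.leaves.length + n) (a.1.toNat + P.deg a.2 + tdeg t + k)) f := by
  have : (form c G).comp (graft a (single t)) = (c a.2 * weight c t) •
      form c (fun n k => G (t.leaves.length + n) (a.1.toNat + P.deg a.2 + tdeg t + k)) := by
    obtain ⟨b, e⟩ := a
    ext s
    have := graft_single_single (b, e) t s
    simp only [LinearMap.comp_apply, Finsupp.lsingle_apply, this,
      LinearMap.smul_apply, form_single, tdeg_node, leaves, List.length_append, smul_eq_mul,
      weight, BTree.weight]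
    ring
  exact congrArg (fun φ => φ f) this

/-! ### The form vanishes on the relations -/

theorem weight_subst (c : P.E → K) (b : Bool) (w : BTree P.E (Fin 3)) (a : Fin 3 → P.Tree Y) :
    weight c (subst b w a) = w.weight c * (w.leaves.map fun x => weight c (a x)).prod := by
  induction w generalizing b with
  | leaf x => simp [subst, leaves, BTree.weight]
  | node e l r hl hr =>
    have h1 := hl false
    have h2 := hr false
    simp only [weight] at h1 h2
    simp only [weight, subst, leaves, BTree.weight, h1, h2, List.map_append, List.prod_append]
    ring

theorem length_leaves_subst (b : Bool) (w : BTree P.E (Fin 3)) (a : Fin 3 → P.Tree Y) :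
    (subst b w a).leaves.length = (w.leaves.map fun x => (a x).leaves.length).sum := by
  induction w generalizing b with
  | leaf x => simp [subst, leaves]
  | node e l r hl hr => simp [subst, leaves, hl, hr]

/-- The bound on the number of leaves forces `w` to have a root vertex. On a single leaf `subst`
ignores `b`, and the summand `b.toNat` would be wrong. -/
theorem tdeg_subst_node (b : Bool) {w : BTree P.E (Fin 3)} (hw : 2 ≤ w.leaves.length)
    (a : Fin 3 → P.Tree Y) : tdeg (subst b w a) =
      b.toNat + w.vdeg P.deg + (w.leaves.map fun x => tdeg (a x)).sum := by
  obtain ⟨e, l, r, rfl⟩ := exists_node hw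
  simp only [subst, tdeg_node, tdeg_subst, vdeg, leaves, List.map_append, List.sum_append]
  omega

/-- The monomials of a relation have the same leaves up to order. After substitution, those of
nonzero weight therefore share the weights of the substituted trees, the number of leaves and the
degree. What remains is the combination of the weights of the monomials, which is zero by `hs`. The
condition on `G` discards the degrees in which Koszul signs could occur. -/
theorem form_evalRel {c : P.E → K} (hc : ∀ e, c e ≠ 0 → P.deg e = 0)
    {r : BTree P.E (Fin 3) →₀ K} (hr : r ∈ P.rel) (hs : r.sum (fun w k => k * w.weight c) = 0)
    {G : ℕ → ℕ → K} (hG : ∀ n k, 2 ≤ k → G n k = 0) (b : Bool) (a : Fin 3 → P.Tree Y) :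
    form c G (evalRel b r a) = 0 := by
  obtain ⟨L, -, hL2, hL⟩ := exists_leaves hr
  rw [evalRel_eq_sum, map_sum]
  -- `C` is the factor common to all monomials; it depends only on the list of variables `L`.
  set C : K := (L.map fun x => weight c (a x)).prod * G (L.map fun x => (a x).leaves.length).sum
    (b.toNat + (L.map fun x => tdeg (a x)).sum) with hC
  have key : ∀ w ∈ r.support, form c G ((r w * (-1) ^ w.koszul P.deg (fun x => tdeg (a x))) •
      (single (subst b w a) : P.Words Y)) = r w * w.weight c * C := by
    intro w hw
    have hp := hL w hw
    rw [map_smul, form_single, weight_subst, length_leaves_subst,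
      tdeg_subst_node b (by rw [hp.length_eq]; exact hL2), (hp.map _).prod_eq, (hp.map _).sum_eq,
      (hp.map fun x => tdeg (a x)).sum_eq, smul_eq_mul]
    by_cases h : w.weight c = 0
    · simp [h]
    · rw [vdeg_eq_zero_of_weight hc h, add_zero]
      -- Either the substituted trees have total degree at most `1` and the Koszul sign is trivial,
      -- or both sides vanish because `G` does.
      by_cases h2 : (L.map fun x => tdeg (a x)).sum ≤ 1
      · rw [koszul_eq_zero hc h (by rwa [(hp.map fun x => tdeg (a x)).sum_eq]), hC]
        ring
      · rw [hC, hG _ _ (by omega)]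
        ring
  rw [Finset.sum_congr rfl key, ← Finset.sum_mul]
  rw [Finsupp.sum] at hs
  rw [hs, zero_mul]

theorem form_relSpan {c : P.E → K} (hc : ∀ e, c e ≠ 0 → P.deg e = 0)
    (hs : ∀ r ∈ P.rel, r.sum (fun w k => k * w.weight c) = 0)
    {G : ℕ → ℕ → K} (hG : ∀ n k, 2 ≤ k → G n k = 0) {f : P.Words Y} (hf : f ∈ relSpan P Y) :
    form c G f = 0 := by
  suffices h : relSpan P Y ≤ LinearMap.ker (form c G) from h hf
  refine Submodule.span_le.2 fun g hg => ?_
  change form c G g = 0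
  clear hf
  -- A graft replaces `G` by a translate. Translation only raises the degree argument, so the
  -- vanishing from degree `2` on is inherited.
  induction hg generalizing G with
  | eval b r hr a => exact form_evalRel hc hr (hs r hr) hG b a
  | left a f t _ ih =>
    rw [form_graft_left, ih fun n k hk => hG _ _ (by omega), mul_zero]
  | right a t f _ ih =>
    rw [form_graft_right, ih fun n k hk => hG _ _ (by omega), mul_zero]

/-! ### The form vanishes on the decomposable words -/

/-- When the weight is nonzero, only suspensions contribute to the degree. The degree can then serve
as the number of suspended vertices. -/
theorem tdeg_isPlain {c : P.E → K} (hc : ∀ e, c e ≠ 0 → P.deg e = 0) {t : P.Tree Y}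
    (h : isPlain t = true) (hw : weight c t ≠ 0) : tdeg t = 0 := by
  induction t with
  | leaf x => rfl
  | node a l r hl hr =>
    obtain ⟨b, e⟩ := a
    simp only [weight, BTree.weight, mul_ne_zero_iff] at hw
    simp only [isPlain, Bool.and_eq_true, Bool.not_eq_true'] at h
    rw [tdeg_node, hl h.1.2 hw.1.2, hr h.2 hw.2, hc e hw.1.1, h.1.1]
    rfl

theorem isNode_of_tdeg {t : P.Tree Y} (h : tdeg t ≠ 0) : t.IsNode := by
  cases t with
  | leaf x => exact h rfl
  | node a l r => trivial

/-- At the vertex where the word decomposes, one input carries the element of the bar construction,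
of positive degree, and the other carries an operation. Neither is a leaf, so each contributes at
least two leaves. -/
theorem four_le_of_isDecomposable {c : P.E → K} (hc : ∀ e, c e ≠ 0 → P.deg e = 0) {t : P.Tree Y}
    (h : IsDecomposable t) (hw : weight c t ≠ 0) (ht : tdeg t ≠ 0) : 4 ≤ t.leaves.length := by
  induction t with
  | leaf x => exact h.elim
  | node a l r hl hr =>
    obtain ⟨b, e⟩ := a
    cases b with
    | true => exact h.elim
    | false =>
      simp only [weight, BTree.weight, mul_ne_zero_iff] at hw
      rw [tdeg_node, hc e hw.1.1, Bool.toNat_false, zero_add, zero_add] at ht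
      simp only [leaves, List.length_append]
      rcases h with ⟨_, h2, h3⟩ | ⟨h1, h2, _⟩ | ⟨h1, h2⟩ | ⟨h1, h2⟩
      · rw [tdeg_isPlain hc h2 hw.2, add_zero] at ht
        have := two_le_length_leaves h3
        have := two_le_length_leaves (isNode_of_tdeg ht)
        omega
      · rw [tdeg_isPlain hc h1 hw.1.2, zero_add] at ht
        have := two_le_length_leaves h2
        have := two_le_length_leaves (isNode_of_tdeg ht)
        omega
      · rw [tdeg_isPlain hc h2 hw.2, add_zero] at ht
        have := hl h1 hw.1.2 ht
        omega
      · rw [tdeg_isPlain hc h1 hw.1.2, zero_add] at ht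
        have := hr h2 hw.2 ht
        omega

/-- The vanishing of `G` in degree `0` is essential: `(xy)dz` is decomposable with only three
leaves. -/
theorem form_decSpan {c : P.E → K} (hc : ∀ e, c e ≠ 0 → P.deg e = 0)
    {G : ℕ → ℕ → K} (hG : ∀ n k, k = 0 ∨ 4 ≤ n → G n k = 0) {f : P.Words Y}
    (hf : f ∈ decSpan P Y) : form c G f = 0 := by
  suffices h : decSpan P Y ≤ LinearMap.ker (form c G) from h hf
  refine Submodule.span_le.2 ?_
  rintro _ ⟨t, ht, rfl⟩
  change form c G (single t) = 0
  rw [form_single]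
  by_cases hw : weight c t = 0
  · rw [hw, zero_mul]
  · rw [hG, mul_zero]
    by_contra! h
    have := four_le_of_isDecomposable hc ht hw h.1
    omega

/-! ### The form vanishes on the boundaries -/

theorem form_eq_zero {c : P.E → K} (G : ℕ → ℕ → K) {f : P.Words Y}
    (hf : ∀ t ∈ f.support, weight c t = 0) : form c G f = 0 := by
  rw [form, Finsupp.linearCombination_apply]
  exact Finset.sum_eq_zero fun t ht => by simp [hf t ht]

/-- Contraction only removes a suspension, and the weight depends on the underlying operations
alone. -/
theorem weight_contract (c : P.E → K) (t : P.Tree Y) :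
    ∀ t' ∈ (contract t : P.Words Y).support, weight c t' = weight c t := by
  induction t with
  | leaf x => simp [contract]
  | node a l r hl hr =>
    obtain ⟨b, e⟩ := a
    refine supp_add (supp_ite _ fun _ => supp_single rfl)
      (supp_smul _ (supp_add ?_ (supp_smul _ ?_)))
    · refine graft_supp _ hl (supp_single (C := fun t => t = r) rfl) ?_
      rintro l' _ h1 rfl
      simp_all [weight, BTree.weight]
    · refine graft_supp _ (supp_single (C := fun t => t = l) rfl) hr ?_
      rintro _ r' rfl h1
      simp_all [weight, BTree.weight]

theorem weight_mark (c : P.E → K) (t : P.Tree Y) :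
    ∀ t' ∈ (mark t : P.Words Y).support, weight c t' = weight c t := by
  induction t with
  | leaf x => exact supp_single rfl
  | node a l r hl hr =>
    obtain ⟨b, e⟩ := a
    cases b with
    | true => exact supp_single rfl
    | false =>
      refine supp_add (supp_ite _ fun _ => ?_) (supp_ite _ fun _ => ?_)
      · refine graft_supp _ hl (supp_single (C := fun t => t = r) rfl) ?_
        rintro l' _ h1 rfl
        simp_all [weight, BTree.weight]
      · refine graft_supp _ (supp_single (C := fun t => t = l) rfl) hr ?_
        rintro _ r' rfl h1
        simp_all [weight, BTree.weight]

theorem isPlain_of_isBranch {t : P.Tree Y} (h : IsBranch t) (ht : tdeg t = 0) :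
    isPlain t = true := by
  induction t with
  | leaf x => simpa [isPlain, IsBranch] using h
  | node a l r hl hr =>
    obtain ⟨b, e⟩ := a
    rw [tdeg_node] at ht
    cases b with
    | true => simp only [Bool.toNat_true] at ht; omega
    | false => simp [isPlain, hl h.1 (by omega), hr h.2 (by omega)]

theorem not_isPlain_of_tdeg {c : P.E → K} (hc : ∀ e, c e ≠ 0 → P.deg e = 0) {t : P.Tree Y}
    (hw : weight c t ≠ 0) (ht : tdeg t = 1) : isPlain t = false := by
  by_contra h
  have := tdeg_isPlain hc (by simpa using h) hw
  omega

theorem contract_of_tdeg {t : P.Tree Y} (ht : tdeg t = 0) : (contract t : P.Words Y) = 0 := by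
  refine Finsupp.support_eq_empty.1 (Finset.eq_empty_of_forall_notMem fun t' h => ?_)
  have := (contract_spec t t' h).2.1
  omega

/-- When the weight is nonzero, degree `1` means exactly one suspended vertex. At every vertex below
it exactly one input carries the suspension, so marking gives back `t` once. -/
theorem form_mark_of_tdeg {c : P.E → K} (hc : ∀ e, c e ≠ 0 → P.deg e = 0) {t : P.Tree Y}
    (hb : IsBranch t) (ht : tdeg t = 1) (G : ℕ → ℕ → K) :
    form c G (mark t) = weight c t * G t.leaves.length 1 := by
  by_cases hw : weight c t = 0
  · rw [hw, zero_mul, form_eq_zero G fun t' h => (weight_mark c t t' h).trans hw]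
  induction t generalizing G with
  | leaf x => exact absurd ht (by simp [tdeg, vdeg])
  | node a l r hl hr =>
    obtain ⟨b, e⟩ := a
    cases b with
    | true => rw [mark, form_single, ht]
    | false =>
      have hw' := hw
      simp only [weight, BTree.weight, mul_ne_zero_iff] at hw'
      have he := hc e hw'.1.1
      have ht' := ht
      rw [tdeg_node, he, Bool.toNat_false, zero_add, zero_add] at ht'
      obtain ⟨h1, h2⟩ | ⟨h1, h2⟩ : (tdeg l = 1 ∧ tdeg r = 0) ∨ (tdeg l = 0 ∧ tdeg r = 1) := by
        omega
      · rw [mark, isPlain_of_isBranch hb.2 h2, not_isPlain_of_tdeg hc hw'.1.2 h1]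
        simp only [if_true, Bool.false_eq_true, if_false, add_zero]
        rw [form_graft_left, hl hb.1 h1 _ hw'.1.2]
        simp only [he, h2, Bool.toNat_false, weight, BTree.weight, leaves, List.length_append]
        ring
      · rw [mark, isPlain_of_isBranch hb.1 h1, not_isPlain_of_tdeg hc hw'.2 h2]
        simp only [if_true, Bool.false_eq_true, if_false, zero_add]
        rw [form_graft_right, hr hb.2 h2 _ hw'.2]
        simp only [he, h1, Bool.toNat_false, weight, BTree.weight, leaves, List.length_append]
        ring

/-- When the weight is nonzero there is a single suspension to remove. Everything that precedes it
has degree `0`, so it is removed with sign `+1`. -/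
theorem form_contract_of_tdeg {c : P.E → K} (hc : ∀ e, c e ≠ 0 → P.deg e = 0) {t : P.Tree Y}
    (hb : IsBranch t) (ht : tdeg t = 1) (G : ℕ → ℕ → K) :
    form c G (contract t) = weight c t * G t.leaves.length 0 := by
  by_cases hw : weight c t = 0
  · rw [hw, zero_mul, form_eq_zero G fun t' h => (weight_contract c t t' h).trans hw]
  induction t generalizing G with
  | leaf x => exact absurd ht (by simp [tdeg, vdeg])
  | node a l r hl hr =>
    obtain ⟨b, e⟩ := a
    have hw' := hw
    simp only [weight, BTree.weight, mul_ne_zero_iff] at hw'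
    have he := hc e hw'.1.1
    have ht' := ht
    rw [tdeg_node, he, add_zero] at ht'
    cases b with
    | true =>
      simp only [Bool.toNat_true] at ht'
      -- The root uses up the whole degree, so there is no suspension in `l` or `r` to contract.
      rw [contract, contract_of_tdeg (t := l) (by omega), contract_of_tdeg (t := r) (by omega)]
      simp only [if_true, map_zero, LinearMap.zero_apply, smul_zero, add_zero]
      rw [form_single, tdeg_node, he, show tdeg l = 0 by omega, show tdeg r = 0 by omega]
      rfl
    | false =>
      rw [Bool.toNat_false, zero_add] at ht'
      obtain ⟨h1, h2⟩ | ⟨h1, h2⟩ : (tdeg l = 1 ∧ tdeg r = 0) ∨ (tdeg l = 0 ∧ tdeg r = 1) := by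
        omega
      · rw [contract, contract_of_tdeg h2, he]
        simp only [Bool.false_eq_true, if_false, Bool.toNat_false, add_zero, pow_zero, one_smul,
          map_zero, smul_zero, zero_add]
        rw [form_graft_left, hl hb.1 h1 _ hw'.1.2]
        simp only [he, h2, Bool.toNat_false, weight, BTree.weight, leaves, List.length_append]
        ring
      · rw [contract, contract_of_tdeg h1, he, h1]
        simp only [Bool.false_eq_true, if_false, Bool.toNat_false, add_zero, pow_zero, one_smul,
          map_zero, LinearMap.zero_apply, zero_add]
        rw [form_graft_right, hr hb.2 h2 _ hw'.2]
        simp only [he, h1, Bool.toNat_false, weight, BTree.weight, leaves, List.length_append]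
        ring

theorem weight_twist (c : P.E → K) (t : P.Tree Y) :
    ∀ t' ∈ (twist t : P.Words Y).support, weight c t' = weight c t := by
  induction t with
  | leaf x => simp [twist]
  | node a l r hl hr =>
    obtain ⟨b, e⟩ := a
    cases b with
    | true =>
      refine supp_add (weight_mark c (node (false, e) l r))
        (supp_smul _ (supp_add ?_ (supp_smul _ ?_)))
      · refine graft_supp _ (weight_contract c l) (supp_single (C := fun t => t = r) rfl) ?_
        rintro l' _ h1 rfl
        simp_all [weight, BTree.weight]
      · refine graft_supp _ (supp_single (C := fun t => t = l) rfl) (weight_contract c r) ?_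
        rintro _ r' rfl h1
        simp_all [weight, BTree.weight]
    | false =>
      refine supp_smul _ (supp_add ?_ (supp_smul _ ?_))
      · refine graft_supp _ hl (supp_single (C := fun t => t = r) rfl) ?_
        rintro l' _ h1 rfl
        simp_all [weight, BTree.weight]
      · refine graft_supp _ (supp_single (C := fun t => t = l) rfl) hr ?_
        rintro _ r' rfl h1
        simp_all [weight, BTree.weight]

/-- With nonzero weight there are exactly two suspensions: the one at the root of the bar element,
and one above it. Removing the first, which is the twisting term, has sign `+1`. Removing the second
has sign `-1`, since the operator of degree `-1` passes the first suspension. The form takes the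
same value on the two resulting trees. -/
theorem form_twist {c : P.E → K} (hc : ∀ e, c e ≠ 0 → P.deg e = 0) {t : P.Tree Y}
    (h : IsWord t) (ht : tdeg t = 2) (G : ℕ → ℕ → K) : form c G (twist t) = 0 := by
  by_cases hw : weight c t = 0
  · exact form_eq_zero G fun t' h => (weight_twist c t t' h).trans hw
  induction t generalizing G with
  | leaf x => exact absurd ht (by simp [tdeg, vdeg])
  | node a l r hl hr =>
    obtain ⟨b, e⟩ := a
    have hw' := hw
    simp only [weight, BTree.weight, mul_ne_zero_iff] at hw'
    have he := hc e hw'.1.1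
    have ht' := ht
    rw [tdeg_node, he, add_zero] at ht'
    cases b with
    | true =>
      have hm := form_mark_of_tdeg hc (t := node (false, e) l r) h
        (by rw [tdeg_node, he]; simp only [Bool.toNat_true, Bool.toNat_false] at ht' ⊢; omega) G
      -- The second suspension lies in exactly one of the two subtrees, and the contraction of the
      -- other subtree is zero.
      obtain ⟨h1, h2⟩ | ⟨h1, h2⟩ : (tdeg l = 1 ∧ tdeg r = 0) ∨ (tdeg l = 0 ∧ tdeg r = 1) := by
        simp only [Bool.toNat_true] at ht'; omega
      · rw [twist, map_add, hm, contract_of_tdeg h2, he]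
        simp only [add_zero, pow_one, map_zero, smul_zero, map_smul]
        rw [form_graft_left, form_contract_of_tdeg hc h.1 h1]
        simp only [he, h2, Bool.toNat_true, weight, BTree.weight, leaves, List.length_append,
          smul_eq_mul]
        ring
      · rw [twist, map_add, hm, contract_of_tdeg h1, he, h1]
        simp only [add_zero, pow_one, pow_zero, one_smul, map_zero, LinearMap.zero_apply,
          zero_add, map_smul]
        rw [form_graft_right, form_contract_of_tdeg hc h.2 h2]
        simp only [he, h1, Bool.toNat_true, weight, BTree.weight, leaves, List.length_append,
          smul_eq_mul]
        ring
    | false =>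
      rw [Bool.toNat_false, zero_add] at ht'
      -- Below the bar element only one input carries it and the other is plain. The differential
      -- acts on the first alone, and the induction hypothesis applies there.
      rcases h with h | h
      · rw [twist, twist_plain h.2, map_zero, smul_zero, add_zero, map_smul, form_graft_left,
          hl h.1 (by rw [tdeg_isPlain hc h.2 hw'.2] at ht'; omega) _ hw'.1.2, mul_zero, smul_zero]
      · rw [twist, twist_plain h.1, map_zero, LinearMap.zero_apply, zero_add, map_smul, map_smul,
          form_graft_right, hr h.2 (by rw [tdeg_isPlain hc h.1 hw'.1.2] at ht'; omega) _ hw'.2,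
          mul_zero, smul_zero, smul_zero]

theorem form_twistL {c : P.E → K} (hc : ∀ e, c e ≠ 0 → P.deg e = 0) {f : P.Words Y}
    (h : ∀ t ∈ f.support, IsWord t ∧ tdeg t = 2) (G : ℕ → ℕ → K) : form c G (twistL f) = 0 := by
  rw [twistL, Finsupp.linearCombination_apply, Finsupp.sum, map_sum]
  exact Finset.sum_eq_zero fun t ht => by
    rw [map_smul, form_twist hc (h t ht).1 (h t ht).2, smul_zero]

/-! ### Relations between variables of degree zero -/

theorem evalRel_sub (b : Bool) (r s : BTree P.E (Fin 3) →₀ K) (a : Fin 3 → P.Tree Y) :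
    (evalRel b (r - s) a : P.Words Y) = evalRel b r a - evalRel b s a :=
  Finsupp.sum_sub_index fun w c d => by rw [sub_mul, Finsupp.single_sub]

theorem koszul_of_forall_eq_zero (d : P.E → ℕ) {δ : Fin 3 → ℕ} (hδ : ∀ x, δ x = 0)
    (w : BTree P.E (Fin 3)) : w.koszul d δ = 0 := by
  induction w with
  | leaf x => rfl
  | node e l r hl hr =>
    have h : δ = fun _ => 0 := funext hδ
    subst h
    simp [koszul, hl, hr]

theorem evalRel_mon (b : Bool) (w : BTree P.E (Fin 3)) {a : Fin 3 → P.Tree Y}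
    (ha : ∀ x, tdeg (a x) = 0) :
    (evalRel b (mon K w) a : P.Words Y) = single (subst b w a) := by
  rw [evalRel, Finsupp.sum_single_index (by simp), koszul_of_forall_eq_zero _ ha]
  simp

/-- On arguments of degree `0` the Koszul signs disappear, so the relation can be read literally. -/
theorem single_sub_single_mem_relSpan {v w : BTree P.E (Fin 3)}
    (h : mon K v - mon K w ∈ P.rel) (b : Bool) {a : Fin 3 → P.Tree Y}
    (ha : ∀ x, tdeg (a x) = 0) :
    (single (subst b v a) - single (subst b w a) : P.Words Y) ∈ relSpan P Y := by
  rw [← evalRel_mon b v ha, ← evalRel_mon b w ha, ← evalRel_sub]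
  exact isRel_mem (.eval b _ h a)

theorem tdeg_leaves (x y z : Y × Bool) :
    ∀ i, tdeg ((![leaf x, leaf y, leaf z] : Fin 3 → P.Tree Y) i) = 0 := by
  intro i
  fin_cases i <;> rfl

/-! ### A criterion for the non-vanishing of the first homology -/

/-- The tree `m(x₀, s m(x₁, x₂))`. -/
abbrev obstructionTree (m : P.E) : P.Tree (Fin 3) :=
  node (false, m) (leaf (0, false)) (node (true, m) (leaf (1, false)) (leaf (2, false)))

/-- The tree `m(x, m(y, z))`. -/
abbrev rightComb (m : P.E) (x y z : Y × Bool) : P.Tree Y :=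
  node (false, m) (leaf x) (node (false, m) (leaf y) (leaf z))

/-- The tree `m(m(x, y), z)`. -/
abbrev leftComb (m : P.E) (x y z : Y × Bool) : P.Tree Y :=
  node (false, m) (node (false, m) (leaf x) (leaf y)) (leaf z)

/-- This is the Leibniz rule for `d(x₁x₂)`, multiplied by `x₀`. The marks stand for the
differentials. -/
theorem twist_obstructionTree {m : P.E} (hm : P.deg m = 0) :
    (twist (obstructionTree m) : P.Words (Fin 3)) =
      single (rightComb m (0, false) (1, true) (2, false)) +
        single (rightComb m (0, false) (1, false) (2, true)) := by
  have h : tdeg (leaf (0, false) : P.Tree (Fin 3)) = 0 := rfl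
  simp [twist, mark, contract, isPlain, hm, h, graft_single_single]

/-- By associativity `x(y dz) = (xy)dz`, and the product `xy` sits at the input of the root that is
not distinguished. -/
theorem rightComb_mem_relL {m : P.E}
    (assoc : ∀ x y z : Y × Bool,
      (single (leftComb m x y z) - single (rightComb m x y z) : P.Words Y) ∈ relSpan P Y)
    (x y z : Y) :
    (single (rightComb m (x, false) (y, false) (z, true)) : P.Words Y) ∈ relL P Y := by
  rw [← sub_sub_cancel (single (leftComb m (x, false) (y, false) (z, true)) : P.Words Y)
    (single (rightComb m (x, false) (y, false) (z, true)))]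
  refine sub_mem (Submodule.mem_sup_right (Submodule.subset_span ⟨_, ?_, rfl⟩))
    (Submodule.mem_sup_left (assoc _ _ _))
  exact Or.inr (Or.inl ⟨rfl, trivial, rfl⟩)

/-- The term `x₀(x₁ dx₂)` is zero in `L̄` by associativity. The term `x₀(dx₁ x₂)` is first turned
into `x₀(x₂ dx₁)`, which only needs commutativity inside the right factor; Perm algebras satisfy
this although their product is not commutative. -/
theorem twist_obstructionTree_mem_relL {m : P.E} (hm : P.deg m = 0)
    (assoc : ∀ x y z : Fin 3 × Bool, (single (leftComb m x y z) - single (rightComb m x y z) :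
      P.Words (Fin 3)) ∈ relSpan P (Fin 3))
    (comm : ∀ x y z : Fin 3 × Bool, (single (rightComb m x y z) - single (rightComb m x z y) :
      P.Words (Fin 3)) ∈ relSpan P (Fin 3)) :
    (twist (obstructionTree m) : P.Words (Fin 3)) ∈ relL P (Fin 3) := by
  rw [twist_obstructionTree hm]
  refine add_mem ?_ (rightComb_mem_relL assoc 0 1 2)
  rw [← sub_add_cancel (single (rightComb m (0, false) (1, true) (2, false)) : P.Words (Fin 3))
    (single (rightComb m (0, false) (2, false) (1, true)))]
  exact add_mem (Submodule.mem_sup_left (comm _ _ _)) (rightComb_mem_relL assoc 0 2 1)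

/-- Vanishing homology is exactness at degree `1`, expressed through elements of the concrete
modules of obstructions. -/
theorem exists_dObstruction_of_isZero {n : ℕ}
    (h : Limits.IsZero ((P.obstructionComplex n).homology 1)) (x : P.Obstruction n 1)
    (hx : P.dObstruction n 0 x = 0) : ∃ y : P.Obstruction n 2, P.dObstruction n 1 y = x := by
  have he := (HomologicalComplex.exactAt_iff_isZero_homology _ _).2 h
  rw [HomologicalComplex.exactAt_iff' _ 2 1 0 (by simp) (by simp),
    ShortComplex.moduleCat_exact_iff] at he
  have h1 : (P.obstructionComplex n).d 1 0 = ModuleCat.ofHom (P.dObstruction n 0) :=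
    ChainComplex.of_d (fun k => ModuleCat.of K (P.Obstruction n k))
      (fun k => ModuleCat.ofHom (P.dObstruction n k)) 0
  have h2 : (P.obstructionComplex n).d 2 1 = ModuleCat.ofHom (P.dObstruction n 1) :=
    ChainComplex.of_d (fun k => ModuleCat.of K (P.Obstruction n k))
      (fun k => ModuleCat.ofHom (P.dObstruction n k)) 1
  obtain ⟨y, hy⟩ := he x (by
    change ((P.obstructionComplex n).d 1 0).hom x = 0
    rw [h1]
    exact hx)
  refine ⟨y, ?_⟩
  change ((P.obstructionComplex n).d 2 1).hom y = x at hy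
  rw [h2] at hy
  exact hy

/-- If a binary operation `m` of degree `0` satisfies `(x y) z = x (y z) = x (z y)`, and if the
relations hold in the algebra of polynomials in one variable without constant term, where `e`
acts as `c e` times the product, then the first homology of the module of obstructions does not
vanish in arity `3`. -/
theorem homology_obstructionComplex_not_isZero {c : P.E → K} (hc : ∀ e, c e ≠ 0 → P.deg e = 0)
    (hs : ∀ r ∈ P.rel, r.sum (fun w k => k * w.weight c) = 0) {m : P.E} (hm : c m ≠ 0)
    (assoc : mon K (node m (node m (leaf 0) (leaf 1)) (leaf 2)) -
      mon K (node m (leaf 0) (node m (leaf 1) (leaf 2))) ∈ P.rel)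
    (comm : ∀ x y z : Fin 3 × Bool, (single (rightComb m x y z) - single (rightComb m x z y) :
      P.Words (Fin 3)) ∈ relSpan P (Fin 3)) :
    ¬ Limits.IsZero ((P.obstructionComplex 3).homology 1) := by
  intro h
  have hd := hc m hm
  have hw : (single (obstructionTree m) : P.Words (Fin 3)) ∈ P.wordSpan 3 1 := by
    refine (Finsupp.mem_supported K _).2 (supp_single ⟨Or.inr ⟨rfl, rfl, rfl⟩, ?_, ?_⟩)
    · simp only [labels, leaves]
      decide
    · simp [tdeg, vdeg, hd]
  let x₀ : P.LBar 3 1 := ⟨(relL P (Fin 3)).mkQ (single (obstructionTree m)), _, hw, rfl⟩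
  have hx₀ : P.piBar 3 1 x₀ = 0 := by
    -- Words with a suspension are zero among the Kähler differentials, so the class lies in the
    -- module of obstructions.
    refine Subtype.ext ((Submodule.Quotient.mk_eq_zero _).2 (Submodule.mem_sup_right ?_))
    exact susp_mem (supp_single (Or.inr (Or.inr (Or.inl rfl))))
  have hdx : P.dObstruction 3 0 ⟨x₀, hx₀⟩ = 0 := by
    refine Subtype.ext (Subtype.ext ((Submodule.Quotient.mk_eq_zero _).2 ?_))
    refine neg_mem ?_
    rw [twistL_single]
    exact twist_obstructionTree_mem_relL hd
      (fun x y z => single_sub_single_mem_relSpan assoc false (tdeg_leaves x y z)) comm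
  -- If the homology were zero, the cycle would be the boundary of the class of some combination `f`
  -- of words of degree `2`.
  obtain ⟨⟨⟨_, f, hf, rfl⟩, _⟩, hy⟩ := exists_dObstruction_of_isZero h ⟨x₀, hx₀⟩ hdx
  have hy' := congrArg (fun z => z.1.1) hy
  have hmem : -twistL f - single (obstructionTree m) ∈ relL P (Fin 3) :=
    (Submodule.Quotient.eq _).1 hy'
  obtain ⟨g, hg, k, hk, hgk⟩ := Submodule.mem_sup.1 hmem
  -- The indicator of three leaves and degree `1` satisfies both constraints: it is zero in degrees
  -- at least `2` for the relations, and zero in degree `0` or from four leaves on for the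
  -- decomposable words.
  let G : ℕ → ℕ → K := fun n k => if n = 3 ∧ k = 1 then 1 else 0
  have hφ := congrArg (form c G) hgk
  rw [map_add, map_sub, map_neg, form_relSpan hc hs (fun n k hk => if_neg (by omega)) hg,
    form_decSpan hc (fun n k hk => if_neg (by omega)) hk,
    form_twistL hc (fun t ht => by
      have := (Finsupp.mem_supported K _).1 hf ht
      exact ⟨this.1, this.2.2⟩), form_single] at hφ
  -- All other terms have vanished, and the equation reads `0 = -(c m)²`.
  simp [BTree.weight, leaves, tdeg, vdeg, hd, G, hm] at hφ

end BinaryPresentation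

/-! ### The weights for Perm, Poisson and Gerstenhaber algebras -/

open BinaryPresentation

variable {K : Type*} [Field K]

theorem sum_mon_weight {N : Type} (c : N → K) (w : BTree N (Fin 3)) :
    (mon K w).sum (fun w k => k * w.weight c) = w.weight c := by
  simp

theorem sum_sub_weight {N : Type} (c : N → K) (r s : BTree N (Fin 3) →₀ K) :
    (r - s).sum (fun w k => k * w.weight c) =
      r.sum (fun w k => k * w.weight c) - s.sum (fun w k => k * w.weight c) :=
  Finsupp.sum_sub_index fun w a b => by rw [sub_mul]

theorem sum_add_weight {N : Type} (c : N → K) (r s : BTree N (Fin 3) →₀ K) :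
    (r + s).sum (fun w k => k * w.weight c) =
      r.sum (fun w k => k * w.weight c) + s.sum (fun w k => k * w.weight c) := by
  classical
  exact Finsupp.sum_add_index' (by simp) fun w a b => by rw [add_mul]

theorem sum_smul_weight {N : Type} (c : N → K) (a : K) (r : BTree N (Fin 3) →₀ K) :
    (a • r).sum (fun w k => k * w.weight c) = a * r.sum (fun w k => k * w.weight c) := by
  rw [Finsupp.sum_smul_index (by simp), Finsupp.mul_sum]
  simp only [mul_assoc]

variable (K) in
/-- The weight that is `1` on the product and `0` on the bracket. -/
def mulWeight : PoissonOp → K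
  | .mul => 1
  | .bracket => 0

/-- A commutative algebra with zero bracket is a Poisson algebra for either symmetry `ε`.
Commutativity and associativity compare two monomials of weight `1`, and in the other relations
every monomial contains a bracket. -/
theorem sum_poissonRel_mulWeight (ε : K) : ∀ r ∈ poissonRel K ε,
    r.sum (fun w k => k * w.weight (mulWeight K)) = 0 := by
  rintro r (rfl | rfl | rfl | rfl | rfl) <;>
    simp only [sum_sub_weight, sum_add_weight, sum_smul_weight, sum_mon_weight] <;>
    simp [BTree.weight, mulWeight]

theorem sum_perm_rel : ∀ r ∈ (perm K).rel,
    r.sum (fun w k => k * w.weight fun _ => (1 : K)) = 0 := by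
  have h : ∀ v w : BTree Unit (Fin 3), (mon K v - mon K w).sum
      (fun w k => k * w.weight fun _ => (1 : K)) = v.weight (fun _ => (1 : K)) -
        w.weight fun _ => (1 : K) := fun v w => by
    rw [sum_sub_weight, sum_mon_weight, sum_mon_weight]
  rintro r (rfl | rfl) <;> exact (h _ _).trans (by simp [BTree.weight])

theorem perm_homology_not_isZero :
    ¬ Limits.IsZero ((obstructionComplex (perm K) 3).homology 1) := by
  refine homology_obstructionComplex_not_isZero (P := perm K) (c := fun _ => (1 : K)) (m := ())
    -- The two defining relations of Perm algebras are exactly the two conditions required of `m`.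
    (fun _ _ => rfl) sum_perm_rel one_ne_zero (Or.inl rfl) fun x y z =>
      single_sub_single_mem_relSpan (P := perm K) (Or.inr rfl) false (tdeg_leaves x y z)

theorem poisson_homology_not_isZero :
    ¬ Limits.IsZero ((obstructionComplex (poisson K) 3).homology 1) := by
  refine homology_obstructionComplex_not_isZero (P := poisson K) (c := mulWeight K)
    (m := PoissonOp.mul) (fun _ _ => rfl) (sum_poissonRel_mulWeight _) one_ne_zero
    (Or.inr (Or.inr (Or.inl rfl))) fun x y z => ?_
  -- Commutativity `yz = zy` is multiplied by `x` on the left. The relation involves only two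
  -- variables, so the third argument `y` of the substitution is arbitrary.
  have := relSpan_graft_right (P := poisson K) (false, PoissonOp.mul)
    (single_sub_single_mem_relSpan (P := poisson K) (Or.inl rfl) false (tdeg_leaves y z y))
    (single (leaf x))
  rwa [map_sub, graft_single_single, graft_single_single] at this

theorem gerst_homology_not_isZero :
    ¬ Limits.IsZero ((obstructionComplex (gerst K) 3).homology 1) := by
  refine homology_obstructionComplex_not_isZero (P := gerst K) (c := mulWeight K)
    (m := PoissonOp.mul) ?_ (sum_poissonRel_mulWeight _) one_ne_zero
    (Or.inr (Or.inr (Or.inl rfl))) fun x y z => ?_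
  -- The product has degree `0`; the bracket, of degree `1`, is excluded because its weight is `0`.
  · rintro (_ | _) h
    · rfl
    · exact absurd rfl h
  · have := relSpan_graft_right (P := gerst K) (false, PoissonOp.mul)
      (single_sub_single_mem_relSpan (P := gerst K) (Or.inl rfl) false (tdeg_leaves y z y))
      (single (leaf x))
    rwa [map_sub, graft_single_single, graft_single_single] at this

end OperadObstruction

theorem mainTheorem7 {K : Type*} [Field K] [CharZero K] :
    (∃ n : ℕ, ¬ CategoryTheory.Limits.IsZero
      ((OperadObstruction.BinaryPresentation.obstructionComplex
        (OperadObstruction.poisson K) n).homology 1)) ∧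
    (∃ n : ℕ, ¬ CategoryTheory.Limits.IsZero
      ((OperadObstruction.BinaryPresentation.obstructionComplex
        (OperadObstruction.perm K) n).homology 1)) ∧
    (∃ n : ℕ, ¬ CategoryTheory.Limits.IsZero
      ((OperadObstruction.BinaryPresentation.obstructionComplex
        (OperadObstruction.gerst K) n).homology 1)) :=
  ⟨⟨3, OperadObstruction.poisson_homology_not_isZero⟩,
    ⟨3, OperadObstruction.perm_homology_not_isZero⟩,
    ⟨3, OperadObstruction.gerst_homology_not_isZero⟩⟩
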